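/- Let $c,\lambda,\alpha,t>0$, let $d\ge 1$ and $n\ge 1$ be integers, and let $m\in\{0,1\}$. Let $N$ be a homogeneous Poisson process of rate $\lambda$ with event times $0=s_0<s_1<s_2<\cdots$, and let $\theta_1,\theta_2,\dots$ be i.i.d. angles, independent of $N$, with density $\frac{\Gamma(m+1)}{\sqrt{\pi}\,\Gamma(m+\frac12)}\sin^{2m}\theta$ on $(0,\pi)$. Put $$X_m(s)=c\sum_{j=1}^{N(s)+1}(\tau_j-\tau_{j-1})\cos\theta_j,\qquad \tau_j=s_j\ (j\le N(s)),\quad \tau_{N(s)+1}=s .$$ Let $R^d(s)=\sqrt{\sum_{i=1}^d B_i(s)^2}$ be the Bessel process of $d$ independent standard Brownian motions started at $0$, let $G_\alpha(t)$ have density $\frac{t^\alpha}{\Gamma(\alpha)}z^{\alpha-1}e^{-tz}$, $z>0$, let $R^d$ and $G_\alpha(t)$ be independent, and let the pair $(R^d,G_\alpha(t))$ be independent of $(N,(\theta_j))$. Put $T=R^d(G_\alpha(t))$, $v_0=\frac n2$, $v_1=n+1$, and suppose $v_m>\frac d2-1$. Understand the conditional law of $X_m(T)$ given $n$ events as the law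 obtained by conditioning on the number of events for each value of the clock and averaging over the law of the clock: $$\int_0^\infty P\{X_m(T)\in \cdot\mid N(T)=n,\ T=s\}\,P\{T\in ds\}.$$ Then this law is absolutely continuous with density, for almost every $x\in\mathbb{R}$, $$\frac{1}{\Gamma(\alpha)B\left(\frac d2,v_m-\frac d2+1\right)}\int_0^1 w^{\frac d2-1}(1-w)^{v_m-\frac d2}\,\frac{\sqrt{2t}}{\sqrt{\pi w}\,c}\left(\frac{\sqrt t\,|x|}{c\sqrt{2w}}\right)^{\alpha-\frac12}K_{\frac12-\alpha}\left(\frac{\sqrt{2t}\,|x|}{c\sqrt w}\right)dw,$$ the integral being absolutely convergent for every $x\neq0$. Here $B(a,b)=\Gamma(a)\Gamma(b)/\Gamma(a+b)$ and $K_\mu$ is the modified Bessel function of the second kind. -/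

import Mathlib

open MeasureTheory ProbabilityTheory
open scoped NNReal ENNReal

noncomputable section

/-- The law on `(0, π)` of an angle with density
`Γ(ν + 1) / (√π Γ(ν + 1/2)) * (sin θ) ^ (2ν)`, `ν ≥ 0`. -/
def frictionAngleLaw (ν : ℝ) : Measure ℝ :=
  (volume.restrict (Set.Ioo 0 Real.pi)).withDensity fun θ =>
    ENNReal.ofReal (Real.Gamma (ν + 1) / (Real.sqrt Real.pi * Real.Gamma (ν + 1 / 2)) *
      Real.sin θ ^ (2 * ν))

/-- The random data driving the motion: the occurrence times `S 0 = 0, S 1, S 2, …` of a homogeneous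
Poisson process of rate `lam` (independent exponential waiting times), and independent angles
`θ 0, θ 1, …` with law `frictionAngleLaw ν`, independent of the Poisson process. The angle `θ j` is
used between the times `S j` and `S (j + 1)`. -/
structure IsFrictionMotion {Ω : Type*} [MeasurableSpace Ω] (P : Measure Ω) (lam ν : ℝ)
    (S θ : ℕ → Ω → ℝ) : Prop where
  start_zero : ∀ ω, S 0 ω = 0
  measurable_time : ∀ j, Measurable (S j)
  measurable_angle : ∀ j, Measurable (θ j)
  gap_law : ∀ j, HasLaw (fun ω => S (j + 1) ω - S j ω) (expMeasure lam) P
  gap_indep : iIndepFun (fun j ω => S (j + 1) ω - S j ω) P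
  angle_law : ∀ j, HasLaw (θ j) (frictionAngleLaw ν) P
  angle_indep : iIndepFun θ P
  indep : IndepFun (fun ω j => S j ω) (fun ω j => θ j ω) P

/-- `N(s)`: the number of events that have occurred up to time `s`. -/
def eventCount {Ω : Type*} (S : ℕ → Ω → ℝ) (s : ℝ) (ω : Ω) : ℕ :=
  Set.ncard {k : ℕ | 1 ≤ k ∧ S k ω ≤ s}

/-- `X(s) = c ∑_{j=0}^{N(s)} (s_{j+1} - s_j) cos θ_j`, where `s_j` is the `j`-th event time for
`j ≤ N(s)` and `s_{N(s)+1} = s`. -/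
def frictionPosition {Ω : Type*} (c : ℝ) (S θ : ℕ → Ω → ℝ) (s : ℝ) (ω : Ω) : ℝ :=
  c * ∑ j ∈ Finset.range (eventCount S s ω + 1),
    ((if j = eventCount S s ω then s else S (j + 1) ω) - S j ω) * Real.cos (θ j ω)

/-- The `d`-dimensional Bessel process `√(∑ B_i(s)^2)`. -/
def besselProcess {Ω : Type*} {d : ℕ} (B : Fin d → ℝ≥0 → Ω → ℝ) (s : ℝ≥0) (ω : Ω) : ℝ :=
  Real.sqrt (∑ i, B i s ω ^ 2)

/-- Independent standard Brownian motions started at zero. -/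
structure IsIndepBrownian {Ω : Type*} [MeasurableSpace Ω] (P : Measure Ω) {d : ℕ}
    (B : Fin d → ℝ≥0 → Ω → ℝ) : Prop where
  measurable : ∀ i s, Measurable (B i s)
  brownian : ∀ i, IsBrownianReal (B i) P
  indep : iIndepFun (fun i ω s => B i s ω) P

/-- A random time process `G` such that for every `s > 0` the variable `G s` has the density
`s ^ a / Γ(a) * z ^ (a - 1) * exp (-(s * z))`, `z > 0`. -/
structure IsGammaTime {Ω : Type*} [MeasurableSpace Ω] (P : Measure Ω) (a : ℝ)
    (G : ℝ → Ω → ℝ) : Prop where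
  measurable : ∀ s, Measurable (G s)
  law : ∀ s, 0 < s → HasLaw (G s) (gammaMeasure a s) P

/-- The conditional law, given the count `n`, of the process `X` stopped at the random clock `T`,
`∫ P(X(T) ∈ · | N(T) = n, T = s) P(T ∈ ds)`: given the value `s` of the clock,
condition on the number of events up to `s`, then average over the law of the clock. -/
def clockConditionalLaw {Ω : Type*} [MeasurableSpace Ω] (P : Measure Ω) [IsFiniteMeasure P]
    (X : ℝ → Ω → ℝ) (N : ℝ → Ω → ℕ) (T : Ω → ℝ) (n : ℕ) : Measure ℝ :=
  (P.map T).bind fun s =>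
    condDistrib (fun ω => X (T ω) ω) (fun ω => (N (T ω) ω, T ω)) P (n, s)

/-- The modified Bessel function of the second kind `K_μ(x)`, `x > 0`, `μ` real. -/
def modifiedBesselK (μ x : ℝ) : ℝ :=
  ∫ u in Set.Ioi (0 : ℝ), Real.exp (-(x * Real.cosh u)) * Real.cosh (μ * u)

/-- `v_0 = n / 2` and `v_1 = n + 1`. -/
def motionIndex (m : Fin 2) (n : ℕ) : ℝ :=
  if m = 0 then (n : ℝ) / 2 else (n : ℝ) + 1

/-- The integrand, in `w ∈ (0, 1)`, of the conditional density at the point `x`. -/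
def mixedKernel (c t a v : ℝ) (d : ℕ) (x w : ℝ) : ℝ :=
  w ^ ((d : ℝ) / 2 - 1) * (1 - w) ^ (v - (d : ℝ) / 2) *
    (Real.sqrt (2 * t) / (Real.sqrt (Real.pi * w) * c)) *
    (Real.sqrt t * |x| / (c * Real.sqrt (2 * w))) ^ (a - 1 / 2) *
    modifiedBesselK (1 / 2 - a) (Real.sqrt (2 * t) * |x| / (c * Real.sqrt w))

/-- The conditional density at the point `x`. -/
def mixedDensity (c t a v : ℝ) (d : ℕ) (x : ℝ) : ℝ :=
  1 / (Real.Gamma a * beta ((d : ℝ) / 2) (v - (d : ℝ) / 2 + 1)) *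
    ∫ w in Set.Ioo (0 : ℝ) 1, mixedKernel c t a v d x w

end

/-! At a fixed time `s`, the moments of the position on the event of `n` jumps can be computed
exactly. The exponential gap densities reduce to a constant on the simplex of event times, so
Dirichlet integrals express the `k`-th moment through `k! / (n + k)!` and the coefficient of degree
`k` in `M ^ (n + 1)`, where `M` is the ordinary generating series of the moments of `cos θ`. For `m
= 0`, `M = (1 - X ^ 2) ^ (-1/2)`; for `m = 1`, `M` is the Catalan series at `X ^ 2 / 4`. In both
cases the coefficient is `(n + k).choose k` times a moment of the density proportional to `(1 - y ^
2) ^ (v - 1/2)`, with `v = motionIndex m n` (`coeff_momentSeries_pow`). Hence, given `n` events, the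
position has the moments of `c s Y` with `Y` of that density (`integral_eventPosition_pow`).

Next fix the value `g` of the gamma time. The squared Bessel variable is `g` times a chi-squared
variable, and the even moments of `Y` times the chi-squared moments equal beta moments times normal
moments (`frictionMoment_mul_chiSqMoment`); odd moments vanish on both sides. The normal law has all
exponential moments, so the moments determine the measure, and the averaged law is that of `c √g √W
Z` with `W` beta and `Z` standard normal (`countConditionedLaw_besselProcess`). Averaging a centred
normal density over a gamma variance produces the function `K`
(`lintegral_gammaMeasure_normalDensity`). The order of the integrals is free by positivity, and the
bound `1 / |x|` on normal densities makes everything finite for `x ≠ 0`.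

It remains to identify the abstract conditional law. The clock is independent of the motion and
almost surely positive, and `n` events have positive probability at each positive time, so the
regular conditional distribution is the elementary conditional probability for almost every value of
the clock (`clockConditionalLaw_apply`). -/

/-! ### Powers of the generating series of the angle moments -/

/-- The moments of the law with density proportional to `(1 - x ^ 2) ^ (ν - 1 / 2)`. -/
noncomputable def frictionMoment (ν : ℝ) : ℕ → ℝ
  | 0 => 1
  | 1 => 0
  | k + 2 => (k + 1) / (k + 2 + 2 * ν) * frictionMoment ν k

lemma frictionMoment_two_add (ν : ℝ) (k : ℕ) :
    frictionMoment ν (k + 2) = (k + 1) / (k + 2 + 2 * ν) * frictionMoment ν k := by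
  rw [frictionMoment]

lemma frictionMoment_odd (ν : ℝ) (j : ℕ) : frictionMoment ν (2 * j + 1) = 0 := by
  induction j with
  | zero => simp [frictionMoment]
  | succ j ih => rw [show 2 * (j + 1) + 1 = (2 * j + 1) + 2 by ring, frictionMoment, ih, mul_zero]

/-- The generating series of the moments. -/
noncomputable def momentSeries (ν : ℝ) : PowerSeries ℝ := PowerSeries.mk (frictionMoment ν)

lemma coeff_one_sub_X_sq_mul (f : PowerSeries ℝ) :
    PowerSeries.coeff 0 ((1 - PowerSeries.X ^ 2) * f) = PowerSeries.coeff 0 f ∧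
    PowerSeries.coeff 1 ((1 - PowerSeries.X ^ 2) * f) = PowerSeries.coeff 1 f ∧
    ∀ k, PowerSeries.coeff (k + 2) ((1 - PowerSeries.X ^ 2) * f) =
      PowerSeries.coeff (k + 2) f - PowerSeries.coeff k f := by
  refine ⟨?_, ?_, fun k => ?_⟩
  · rw [sub_mul, one_mul, map_sub, PowerSeries.coeff_X_pow_mul', if_neg (by norm_num), sub_zero]
  · rw [sub_mul, one_mul, map_sub, PowerSeries.coeff_X_pow_mul', if_neg (by norm_num), sub_zero]
  · rw [sub_mul, one_mul, map_sub, PowerSeries.coeff_X_pow_mul]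

/-- This differential equation characterises `(1 - X ^ 2) ^ (-1/2)` up to a constant, and replaces
that closed form throughout. -/
lemma momentSeries_zero_deriv :
    (1 - PowerSeries.X ^ 2) * PowerSeries.derivative ℝ (momentSeries 0) =
      PowerSeries.X * momentSeries 0 := by
  obtain ⟨h0, h1, h2⟩ := coeff_one_sub_X_sq_mul (PowerSeries.derivative ℝ (momentSeries 0))
  ext k
  rcases k with _ | _ | k
  · rw [h0, PowerSeries.coeff_derivative, PowerSeries.coeff_zero_X_mul]
    simp [momentSeries, frictionMoment]
  · rw [zero_add, h1, PowerSeries.coeff_derivative, ← zero_add 1, PowerSeries.coeff_succ_X_mul]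
    simp [momentSeries, frictionMoment]
    norm_num
  · rw [show k + 1 + 1 = k + 2 from rfl, h2, show k + 2 = (k + 1) + 1 from rfl,
      PowerSeries.coeff_succ_X_mul, PowerSeries.coeff_derivative, PowerSeries.coeff_derivative]
    simp only [momentSeries, PowerSeries.coeff_mk]
    rw [show k + 1 + 1 + 1 = (k + 1) + 2 from rfl, frictionMoment]
    push_cast
    field_simp
    ring

/-- Raising to the power `n` multiplies the logarithmic derivative by `n`. -/
lemma momentSeries_zero_pow_deriv (n : ℕ) :
    (1 - PowerSeries.X ^ 2) * PowerSeries.derivative ℝ (momentSeries 0 ^ n) =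
      (n : PowerSeries ℝ) * (PowerSeries.X * momentSeries 0 ^ n) := by
  rcases n with _ | n
  · simp
  · rw [Derivation.leibniz_pow]
    simp only [Nat.add_sub_cancel, smul_eq_mul, nsmul_eq_mul]
    rw [show (1 - PowerSeries.X ^ 2 : PowerSeries ℝ) * (((n + 1 : ℕ) : PowerSeries ℝ) *
      (momentSeries 0 ^ n * PowerSeries.derivative ℝ (momentSeries 0))) =
      ((n + 1 : ℕ) : PowerSeries ℝ) * momentSeries 0 ^ n * ((1 - PowerSeries.X ^ 2) *
        PowerSeries.derivative ℝ (momentSeries 0)) by ring, momentSeries_zero_deriv]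
    ring

lemma coeff_momentSeries_zero_pow_two_add (n k : ℕ) :
    PowerSeries.coeff (k + 2) (momentSeries 0 ^ n) * (k + 2) =
      (n + k) * PowerSeries.coeff k (momentSeries 0 ^ n) := by
  have h := congrArg (PowerSeries.coeff (k + 1)) (momentSeries_zero_pow_deriv n)
  obtain ⟨-, h1, h2⟩ :=
    coeff_one_sub_X_sq_mul (PowerSeries.derivative ℝ (momentSeries 0 ^ n))
  rw [← nsmul_eq_mul, map_nsmul, PowerSeries.coeff_succ_X_mul, nsmul_eq_mul] at h
  rcases k with _ | k
  · rw [zero_add, h1, PowerSeries.coeff_derivative] at h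
    push_cast at h ⊢
    linarith
  · rw [show k + 1 + 1 = k + 2 from rfl, h2, PowerSeries.coeff_derivative,
      PowerSeries.coeff_derivative] at h
    push_cast at h ⊢
    linarith

/-- The differential equation gives a two-step recurrence for the coefficients; the right-hand side
obeys the same recurrence with the same two initial values. -/
lemma coeff_momentSeries_zero_pow (n k : ℕ) :
    PowerSeries.coeff k (momentSeries 0 ^ (n + 1)) =
      (n + k).choose k * frictionMoment (n / 2) k := by
  induction k using Nat.twoStepInduction with
  | zero => simp [frictionMoment, momentSeries]
  | one =>
    have h := congrArg (PowerSeries.coeff 0) (momentSeries_zero_pow_deriv (n + 1))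
    rw [(coeff_one_sub_X_sq_mul _).1, PowerSeries.coeff_derivative, ← nsmul_eq_mul, map_nsmul,
      PowerSeries.coeff_zero_X_mul] at h
    simpa [frictionMoment] using h
  | more k ih _ =>
    have h := coeff_momentSeries_zero_pow_two_add (n + 1) k
    rw [ih] at h
    rw [frictionMoment, ← mul_left_inj' (show ((k : ℝ) + 2) ≠ 0 by positivity), h]
    -- Ratio of binomial coefficients over two steps, from two uses of the absorption identity.
    have h1 : (((n + (k + 2)).choose (k + 2) : ℕ) : ℝ) * ((k + 2) * (k + 1)) =
        (n + k + 2) * (n + k + 1) * ((n + k).choose k : ℕ) := by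
      have e1 := Nat.add_one_mul_choose_eq (n + k + 1) (k + 1)
      have e2 := Nat.add_one_mul_choose_eq (n + k) k
      have e1' : ((n : ℝ) + k + 1 + 1) * ((n + k + 1).choose (k + 1) : ℕ) =
        ((n + k + 1 + 1).choose (k + 1 + 1) : ℕ) * (k + 1 + 1) := by exact_mod_cast e1
      have e2' : ((n : ℝ) + k + 1) * ((n + k).choose k : ℕ) =
        ((n + k + 1).choose (k + 1) : ℕ) * (k + 1) := by exact_mod_cast e2
      rw [show n + (k + 2) = n + k + 1 + 1 by ring]
      linear_combination (-(k + 1 : ℝ)) * e1' - (n + k + 2 : ℝ) * e2'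
    have h2 : (0 : ℝ) < k + 2 + 2 * (n / 2) := by positivity
    rw [show (k : ℝ) + 2 + 2 * (n / 2) = n + k + 2 by ring] at h2 ⊢
    field_simp
    push_cast
    linear_combination (-frictionMoment (n / 2) k) * h1

/-- The rescaled coefficients of the powers of the Catalan series. -/
noncomputable def raneyCoeff (n j : ℕ) : ℝ :=
  (n + 1) * (2 * j + n).factorial / (4 ^ j * j.factorial * (j + n + 1).factorial)

lemma raneyCoeff_zero_right (n : ℕ) : raneyCoeff n 0 = 1 := by
  have : ((n.factorial : ℕ) : ℝ) ≠ 0 := by positivity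
  have h : ((n : ℝ) + 1) ≠ 0 := by positivity
  simp only [raneyCoeff, Nat.factorial_succ, mul_zero, zero_add, pow_zero, Nat.factorial_zero]
  push_cast
  field_simp

lemma raneyCoeff_zero_succ (j : ℕ) : raneyCoeff 0 (j + 1) = raneyCoeff 1 j / 4 := by
  simp only [raneyCoeff]
  rw [show 2 * (j + 1) + 0 = (2 * j + 1) + 1 by ring, show j + 1 + 0 + 1 = j + 1 + 1 by ring,
    Nat.factorial_succ (2 * j + 1), Nat.factorial_succ j]
  push_cast
  field_simp
  ring

lemma raneyCoeff_succ_succ (n j : ℕ) :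
    raneyCoeff (n + 1) (j + 1) = raneyCoeff n (j + 1) + raneyCoeff (n + 2) j / 4 := by
  simp only [raneyCoeff]
  rw [show 2 * (j + 1) + (n + 1) = (2 * j + n + 2) + 1 by ring,
    show 2 * (j + 1) + n = 2 * j + n + 2 by ring,
    show 2 * j + (n + 2) = 2 * j + n + 2 by ring,
    show j + 1 + (n + 1) + 1 = (j + n + 2) + 1 by ring, show j + 1 + n + 1 = j + n + 2 by ring,
    show j + (n + 2) + 1 = (j + n + 2) + 1 by ring,
    Nat.factorial_succ (2 * j + n + 2), Nat.factorial_succ j, Nat.factorial_succ (j + n + 2)]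
  push_cast
  field_simp
  ring

lemma raneyCoeff_zero_eq_catalan (j : ℕ) : raneyCoeff 0 j = (1 / 4) ^ j * catalan j := by
  have h : ((j : ℝ) + 1) * catalan j = j.centralBinom := by
    exact_mod_cast succ_mul_catalan_eq_centralBinom j
  have h2 : ((j.centralBinom : ℕ) : ℝ) * j.factorial * j.factorial = (2 * j).factorial := by
    have := Nat.choose_mul_factorial_mul_factorial (show j ≤ 2 * j by omega)
    rw [show 2 * j - j = j by omega] at this
    exact_mod_cast this
  simp only [raneyCoeff, add_zero, Nat.factorial_succ]
  push_cast
  rw [← h2, ← h]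
  field_simp
  simp

/-- The series with coefficients `raneyCoeff n`. -/
noncomputable def raneySeries (n : ℕ) : PowerSeries ℝ := PowerSeries.mk (raneyCoeff n)

/-- Segner's convolution recurrence for the Catalan numbers, with the variable scaled by `1 / 4`. -/
lemma raneySeries_zero_eq : raneySeries 0 = 1 + PowerSeries.C (1 / 4 : ℝ) * PowerSeries.X *
    raneySeries 0 ^ 2 := by
  ext j
  rcases j with _ | j
  · simp [raneySeries, raneyCoeff_zero_right]
  · rw [map_add, mul_assoc, PowerSeries.coeff_C_mul, PowerSeries.coeff_succ_X_mul, pow_two,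
      PowerSeries.coeff_mul]
    simp only [raneySeries, PowerSeries.coeff_mk, PowerSeries.coeff_one, raneyCoeff_zero_eq_catalan]
    rw [if_neg (Nat.succ_ne_zero j), catalan_succ', zero_add]
    push_cast
    rw [Finset.mul_sum, Finset.mul_sum]
    refine Finset.sum_congr rfl fun p hp => ?_
    rw [← Finset.HasAntidiagonal.mem_antidiagonal.mp hp]
    ring

/-- The explicit coefficients satisfy `R (n + 1) = R n + (X / 4) R (n + 2)`. Multiplying the
quadratic equation for `R 0` by a power of `R 0` gives the same relation for powers, so cancelling
`X / 4` advances a two-step induction. -/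
lemma raneySeries_eq_pow (n : ℕ) : raneySeries n = raneySeries 0 ^ (n + 1) := by
  have hC : (PowerSeries.C (1 / 4 : ℝ) * PowerSeries.X : PowerSeries ℝ) ≠ 0 := by
    refine mul_ne_zero ?_ PowerSeries.X_ne_zero
    simp
  have h2 : ∀ n, raneySeries (n + 1) = raneySeries n +
      PowerSeries.C (1 / 4 : ℝ) * PowerSeries.X * raneySeries (n + 2) := by
    intro n
    ext j
    rcases j with _ | j
    · simp [raneySeries, raneyCoeff_zero_right]
    · rw [map_add, mul_assoc, PowerSeries.coeff_C_mul, PowerSeries.coeff_succ_X_mul]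
      simp only [raneySeries, PowerSeries.coeff_mk, raneyCoeff_succ_succ]
      ring
  induction n using Nat.twoStepInduction with
  | zero => simp
  | one =>
    apply mul_left_cancel₀ hC
    have h := raneySeries_zero_eq
    have h1 : raneySeries 0 = 1 + PowerSeries.C (1 / 4 : ℝ) * PowerSeries.X * raneySeries 1 := by
      ext j
      rcases j with _ | j
      · simp [raneySeries, raneyCoeff_zero_right]
      · rw [map_add, mul_assoc, PowerSeries.coeff_C_mul, PowerSeries.coeff_succ_X_mul]
        simp only [raneySeries, PowerSeries.coeff_mk, raneyCoeff_zero_succ, PowerSeries.coeff_one]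
        rw [if_neg (Nat.succ_ne_zero j)]
        ring
    linear_combination h - h1
  | more n ih1 ih2 =>
    apply mul_left_cancel₀ hC
    have h := h2 n
    rw [ih1, ih2] at h
    linear_combination (-1 : PowerSeries ℝ) * h + raneySeries 0 ^ (n + 1) * raneySeries_zero_eq

/-- Both sides have the same ratio between consecutive `j`. For `n = 0` this says that the even
moments of the semicircle law are Catalan numbers over `4 ^ j`. -/
lemma choose_mul_frictionMoment_even (n j : ℕ) :
    ((n + 2 * j).choose (2 * j) : ℕ) * frictionMoment (n + 1) (2 * j) = raneyCoeff n j := by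
  have hc : ∀ k : ℕ, (((n + k).choose k : ℕ) : ℝ) = (n + k).factorial / (n.factorial * k.factorial) := by
    intro k
    rw [Nat.cast_choose ℝ (Nat.le_add_left k n), Nat.add_sub_cancel, mul_comm]
  induction j with
  | zero => simp [frictionMoment, raneyCoeff_zero_right]
  | succ j ih =>
    have e : raneyCoeff n (j + 1) = raneyCoeff n j *
        ((2 * j + n + 2) * (2 * j + n + 1) / (4 * (j + 1) * (j + n + 2))) := by
      simp only [raneyCoeff]
      rw [show 2 * (j + 1) + n = (2 * j + n + 1) + 1 by ring,
        show j + 1 + n + 1 = (j + n + 1) + 1 by ring, Nat.factorial_succ (2 * j + n + 1),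
        Nat.factorial_succ (2 * j + n), Nat.factorial_succ j, Nat.factorial_succ (j + n + 1)]
      push_cast
      field_simp
      ring
    rw [e, ← ih, show 2 * (j + 1) = 2 * j + 2 by ring, frictionMoment, hc, hc,
      show n + (2 * j + 2) = (n + 2 * j + 1) + 1 by ring, Nat.factorial_succ (n + 2 * j + 1),
      Nat.factorial_succ (n + 2 * j), Nat.factorial_succ (2 * j + 1), Nat.factorial_succ (2 * j)]
    push_cast
    field_simp
    ring

lemma momentSeries_one_eq_expand :
    momentSeries 1 = PowerSeries.expand 2 two_ne_zero (raneySeries 0) := by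
  ext k
  rcases Nat.even_or_odd' k with ⟨j, rfl | rfl⟩
  · rw [PowerSeries.coeff_expand_mul]
    have := choose_mul_frictionMoment_even 0 j
    simpa [momentSeries, raneySeries] using this
  · rw [PowerSeries.coeff_expand_of_not_dvd _ _ _ (by omega)]
    simp [momentSeries, frictionMoment_odd]

lemma coeff_momentSeries_one_pow (n k : ℕ) :
    PowerSeries.coeff k (momentSeries 1 ^ (n + 1)) =
      (n + k).choose k * frictionMoment (n + 1) k := by
  rw [momentSeries_one_eq_expand, ← map_pow, ← raneySeries_eq_pow]
  rcases Nat.even_or_odd' k with ⟨j, rfl | rfl⟩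
  · rw [PowerSeries.coeff_expand_mul, choose_mul_frictionMoment_even]
    simp [raneySeries]
  · rw [PowerSeries.coeff_expand_of_not_dvd _ _ _ (by omega), frictionMoment_odd, mul_zero]

lemma coeff_momentSeries_pow (m : Fin 2) (n k : ℕ) :
    PowerSeries.coeff k (momentSeries ((m : ℕ) : ℝ) ^ (n + 1)) =
      (n + k).choose k * frictionMoment (motionIndex m n) k := by
  fin_cases m
  · simpa [motionIndex] using coeff_momentSeries_zero_pow n k
  · simpa [motionIndex] using coeff_momentSeries_one_pow n k

/-! ### Moments of the cosine of an angle -/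

lemma integral_cos_pow_zero_pi (k : ℕ) :
    ∫ x in (0 : ℝ)..Real.pi, Real.cos x ^ k = Real.pi * frictionMoment 0 k := by
  induction k using Nat.twoStepInduction with
  | zero => simp [frictionMoment]
  | one => simp [frictionMoment]
  | more k ih _ =>
    rw [integral_cos_pow, ih, frictionMoment]
    simp
    ring

/-- Reflects `sin ^ 2 = 1 - cos ^ 2`; the factor `2` is the ratio of the normalising constants `2 /
π` and `1 / π`. -/
lemma frictionMoment_one_eq (k : ℕ) :
    2 * (frictionMoment 0 k - frictionMoment 0 (k + 2)) = frictionMoment 1 k := by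
  induction k using Nat.twoStepInduction with
  | zero => simp [frictionMoment]; norm_num
  | one => simp [frictionMoment]
  | more k ih _ =>
    rw [frictionMoment_two_add 1, ← ih, frictionMoment_two_add 0 (k + 2), frictionMoment_two_add 0 k]
    push_cast
    field_simp
    ring

lemma integral_frictionAngleLaw (ν : ℝ) (hν : 0 ≤ ν) (f : ℝ → ℝ) :
    ∫ θ, f θ ∂(frictionAngleLaw ν) = ∫ θ in Set.Ioo 0 Real.pi,
      Real.Gamma (ν + 1) / (Real.sqrt Real.pi * Real.Gamma (ν + 1 / 2)) *
      Real.sin θ ^ (2 * ν) * f θ := by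
  rw [frictionAngleLaw, integral_withDensity_eq_integral_toReal_smul (by fun_prop)
    (Filter.Eventually.of_forall fun _ => ENNReal.ofReal_lt_top)]
  refine setIntegral_congr_fun measurableSet_Ioo fun θ hθ => ?_
  have h1 : 0 ≤ Real.sin θ := (Real.sin_pos_of_mem_Ioo hθ).le
  have h2 : 0 < Real.Gamma (ν + 1) := Real.Gamma_pos_of_pos (by linarith)
  have h3 : 0 < Real.Gamma (ν + 1 / 2) := Real.Gamma_pos_of_pos (by linarith)
  simp only [smul_eq_mul]
  rw [ENNReal.toReal_ofReal (by positivity)]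

lemma integral_cos_pow_frictionAngleLaw (m : Fin 2) (k : ℕ) :
    ∫ θ, Real.cos θ ^ k ∂(frictionAngleLaw ((m : ℕ) : ℝ)) =
      frictionMoment ((m : ℕ) : ℝ) k := by
  have hpi := Real.pi_pos
  have hs : Real.sqrt Real.pi * Real.sqrt Real.pi = Real.pi := Real.mul_self_sqrt hpi.le
  have hs0 : Real.sqrt Real.pi ≠ 0 := by positivity
  rw [integral_frictionAngleLaw _ (by positivity), ← integral_Ioc_eq_integral_Ioo,
    ← intervalIntegral.integral_of_le hpi.le]
  fin_cases m
  · simp only [Nat.cast_zero, mul_zero, Real.rpow_zero, zero_add, mul_one,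
      Real.Gamma_one, Real.Gamma_one_half_eq]
    rw [intervalIntegral.integral_const_mul, integral_cos_pow_zero_pi, hs]
    field_simp
  · have hG : Real.Gamma (3 / 2) = Real.sqrt Real.pi / 2 := by
      rw [show (3 / 2 : ℝ) = 1 / 2 + 1 by norm_num, Real.Gamma_add_one (by norm_num),
        Real.Gamma_one_half_eq]
      ring
    simp only [Nat.cast_one, mul_one]
    have e : ∀ θ : ℝ, Real.Gamma (1 + 1) / (Real.sqrt Real.pi * Real.Gamma (1 + 1 / 2)) *
        Real.sin θ ^ (2 : ℝ) * Real.cos θ ^ k =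
        2 / Real.pi * (Real.cos θ ^ k - Real.cos θ ^ (k + 2)) := by
      intro θ
      rw [show (1 + 1 / 2 : ℝ) = 3 / 2 by norm_num, hG, Real.Gamma_add_one (by norm_num),
        Real.Gamma_one, Real.rpow_two, Real.sin_sq, ← mul_div_assoc, hs]
      field_simp
      ring
    simp only [e]
    rw [intervalIntegral.integral_const_mul, intervalIntegral.integral_sub,
      integral_cos_pow_zero_pi, integral_cos_pow_zero_pi, ← frictionMoment_one_eq]
    · field_simp
    all_goals apply Continuous.intervalIntegrable; fun_prop

/-! ### Independence, and integrating out one gap and one angle -/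

/-- Used with `A`, `B` the past and next gaps and `C`, `D` the past and next angles: it makes the
whole past independent of the next step. -/
lemma IndepFun.prodMk_prodMk_comm {Ω α β γ δ : Type*} [MeasurableSpace Ω] [MeasurableSpace α]
    [MeasurableSpace β] [MeasurableSpace γ] [MeasurableSpace δ] {P : Measure Ω}
    [IsProbabilityMeasure P] {A : Ω → α} {B : Ω → β} {C : Ω → γ} {D : Ω → δ}
    (hA : Measurable A) (hB : Measurable B) (hC : Measurable C) (hD : Measurable D)
    (hAB : IndepFun A B P) (hCD : IndepFun C D P)
    (h : IndepFun (fun ω => (A ω, B ω)) (fun ω => (C ω, D ω)) P) :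
    IndepFun (fun ω => (A ω, C ω)) (fun ω => (B ω, D ω)) P := by
  have hAC : IndepFun A C P := h.comp measurable_fst measurable_fst
  have hBD : IndepFun B D P := h.comp measurable_snd measurable_snd
  rw [indepFun_iff_map_prod_eq_prod_map_map (by fun_prop) (by fun_prop)] at h hAB hCD hAC hBD ⊢
  rw [hAB, hCD] at h
  rw [hAC, hBD]
  have := Measure.isProbabilityMeasure_map (μ := P) hA.aemeasurable
  have := Measure.isProbabilityMeasure_map (μ := P) hB.aemeasurable
  have := Measure.isProbabilityMeasure_map (μ := P) hC.aemeasurable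
  have := Measure.isProbabilityMeasure_map (μ := P) hD.aemeasurable
  set μA := P.map A
  set μB := P.map B
  set μC := P.map C
  set μD := P.map D
  -- The product of the four laws is carried to itself with the two middle factors exchanged, by
  -- reassociating, swapping and reassociating back.
  have i1 := measurePreserving_prodAssoc μA μB (μC.prod μD)
  have i2 := (MeasurePreserving.id μA).prod (MeasurePreserving.symm _
    (measurePreserving_prodAssoc μB μC μD))
  have i3 := (MeasurePreserving.id μA).prod
    ((Measure.measurePreserving_swap (μ := μB) (ν := μC)).prod (MeasurePreserving.id μD))
  have i4 := (MeasurePreserving.id μA).prod (measurePreserving_prodAssoc μC μB μD)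
  have i5 := MeasurePreserving.symm _ (measurePreserving_prodAssoc μA μC (μB.prod μD))
  have i := i5.comp (i4.comp (i3.comp (i2.comp i1)))
  rw [← i.map_eq, ← h, Measure.map_map i.measurable (by fun_prop)]
  rfl

lemma integral_expMeasure {lam : ℝ} (hlam : 0 < lam) (f : ℝ → ℝ) :
    ∫ x, f x ∂(expMeasure lam) = ∫ x in Set.Ioi 0, lam * Real.exp (-(lam * x)) * f x := by
  rw [expMeasure, gammaMeasure,
    show gammaPDF 1 lam = fun x => ENNReal.ofReal (gammaPDFReal 1 lam x) from rfl,
    integral_withDensity_eq_integral_toReal_smul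
    (measurable_gammaPDFReal 1 lam).ennreal_ofReal
    (Filter.Eventually.of_forall fun _ => ENNReal.ofReal_lt_top),
    ← integral_Ici_eq_integral_Ioi, ← integral_indicator measurableSet_Ici]
  refine integral_congr_ae (Filter.Eventually.of_forall fun x => ?_)
  simp only [smul_eq_mul, Set.indicator_apply, Set.mem_Ici]
  rw [ENNReal.toReal_ofReal (gammaPDFReal_nonneg one_pos hlam x), gammaPDFReal]
  split_ifs <;> simp

/-- A beta integral with integer exponents; integration by parts lowers `p` and raises `i`. -/
lemma integral_sub_pow_mul_pow (r : ℝ) (p i : ℕ) :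
    ∫ x in (0 : ℝ)..r, (r - x) ^ p * x ^ i =
      p.factorial * i.factorial / (p + i + 1).factorial * r ^ (p + i + 1) := by
  induction p generalizing i with
  | zero =>
    simp [Nat.factorial_succ]
    field_simp
  | succ p ih =>
    have h : ∀ x : ℝ, HasDerivAt (fun x => (r - x) ^ (p + 1) * x ^ (i + 1))
        ((i + 1) * ((r - x) ^ (p + 1) * x ^ i) - (p + 1) * ((r - x) ^ p * x ^ (i + 1))) x := by
      intro x
      have h1 := (((hasDerivAt_id x).const_sub r).pow (p + 1)).mul (hasDerivAt_pow (i + 1) x)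
      refine h1.congr_deriv ?_
      simp only [id_eq, Pi.pow_apply, Nat.add_sub_cancel]
      push_cast
      ring
    have h2 := intervalIntegral.integral_eq_sub_of_hasDerivAt (a := 0) (b := r)
      (fun x _ => h x) (by apply Continuous.intervalIntegrable; fun_prop)
    rw [intervalIntegral.integral_sub (by apply Continuous.intervalIntegrable; fun_prop)
      (by apply Continuous.intervalIntegrable; fun_prop), intervalIntegral.integral_const_mul,
      intervalIntegral.integral_const_mul, ih] at h2
    simp only [sub_self, ne_eq, Nat.add_eq_zero_iff, one_ne_zero, and_false, not_false_eq_true,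
      zero_pow, zero_mul, mul_zero] at h2
    have hi : ((i : ℝ) + 1) ≠ 0 := by positivity
    rw [← mul_right_inj' hi, sub_eq_zero.mp h2, Nat.factorial_succ p, Nat.factorial_succ i,
      show p + 1 + i + 1 = p + (i + 1) + 1 by ring]
    push_cast
    ring

/-- `exp (lam e) (r - e) ^ p e ^ i` on `e ≤ r`, and zero elsewhere. -/
noncomputable def truncatedGap (lam r : ℝ) (p i : ℕ) (e : ℝ) : ℝ :=
  if e ≤ r then Real.exp (lam * e) * (r - e) ^ p * e ^ i else 0

lemma measurable_truncatedGap (lam r : ℝ) (p i : ℕ) : Measurable (truncatedGap lam r p i) :=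
  Measurable.ite measurableSet_Iic (by fun_prop) measurable_const

lemma expMeasure_ae_nonneg (lam : ℝ) : ∀ᵐ x ∂(expMeasure lam), 0 ≤ x := by
  have h : expMeasure lam (Set.Iio 0) = 0 := by
    rw [expMeasure, gammaMeasure, withDensity_apply _ measurableSet_Iio]
    exact lintegral_gammaPDF_of_nonpos le_rfl
  simpa [ae_iff, Set.Iio] using h

lemma expMeasure_ae_pos (lam : ℝ) : ∀ᵐ x ∂(expMeasure lam), 0 < x := by
  have h : ∀ᵐ x ∂(expMeasure lam), x ≠ 0 := by
    rw [expMeasure, gammaMeasure]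
    exact (withDensity_absolutelyContinuous _ _).ae_le (Measure.ae_ne volume 0)
  filter_upwards [h, expMeasure_ae_nonneg lam] with x h1 h2 using lt_of_le_of_ne h2 h1.symm

lemma integrable_truncatedGap {lam : ℝ} (hlam : 0 < lam) (r : ℝ) (p i : ℕ) :
    Integrable (truncatedGap lam r p i) (expMeasure lam) := by
  have := isProbabilityMeasure_expMeasure hlam
  refine Integrable.of_bound (measurable_truncatedGap _ _ _ _).aestronglyMeasurable
    (Real.exp (lam * |r|) * |r| ^ p * |r| ^ i) ?_
  filter_upwards [expMeasure_ae_nonneg lam] with e he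
  rw [truncatedGap]
  split_ifs with h
  · rw [Real.norm_eq_abs, abs_mul, abs_mul, Real.abs_exp, abs_pow, abs_pow]
    have h1 : r ≤ |r| := le_abs_self r
    have h2 : |r - e| ≤ |r| := by rw [abs_of_nonneg (by linarith)]; linarith
    have h3 : |e| ≤ |r| := by rw [abs_of_nonneg he]; linarith
    exact mul_le_mul (mul_le_mul (Real.exp_le_exp.mpr (by gcongr; linarith))
      (pow_le_pow_left₀ (abs_nonneg _) h2 p) (by positivity) (by positivity))
      (pow_le_pow_left₀ (abs_nonneg _) h3 i) (by positivity) (by positivity)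
  · rw [norm_zero]; positivity

/-- The factor `exp (lam e)` cancels the exponential density, leaving `lam` times a beta integral
over `[0, r]`. -/
lemma integral_truncatedGap {lam : ℝ} (hlam : 0 < lam) (r : ℝ) (p i : ℕ) :
    ∫ e, truncatedGap lam r p i e ∂(expMeasure lam) =
      if 0 ≤ r then lam * (p.factorial * i.factorial / (p + i + 1).factorial) * r ^ (p + i + 1)
      else 0 := by
  rw [integral_expMeasure hlam]
  split_ifs with hr
  · have e : ∀ x, lam * Real.exp (-(lam * x)) * truncatedGap lam r p i x =
        (Set.Iic r).indicator (fun x => lam * ((r - x) ^ p * x ^ i)) x := by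
      intro x
      rw [truncatedGap, Set.indicator_apply]
      simp only [Set.mem_Iic]
      split_ifs
      · rw [Real.exp_neg]; field_simp
      · simp
    simp only [e]
    rw [setIntegral_indicator measurableSet_Iic, Set.Ioi_inter_Iic,
      ← intervalIntegral.integral_of_le hr, intervalIntegral.integral_const_mul,
      integral_sub_pow_mul_pow]
    ring
  · refine setIntegral_eq_zero_of_forall_eq_zero fun x hx => ?_
    rw [truncatedGap, if_neg, mul_zero]
    exact not_le.mpr (lt_trans (not_le.mp hr) hx)

lemma integral_expMeasure_tail {lam r : ℝ} (hlam : 0 < lam) (hr : 0 ≤ r) :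
    ∫ e, (if r < e then (1 : ℝ) else 0) ∂(expMeasure lam) = Real.exp (-(lam * r)) := by
  have := isProbabilityMeasure_expMeasure hlam
  have e : (fun e : ℝ => if r < e then (1 : ℝ) else 0) = (Set.Ioi r).indicator 1 := by
    ext e; simp [Set.indicator_apply]
  have h := cdf_expMeasure_eq hlam r
  rw [cdf_eq_real, if_pos hr] at h
  rw [e, integral_indicator_one measurableSet_Ioi, ← Set.compl_Iic,
    measureReal_compl measurableSet_Iic, h]
  simp

/-- `exp (lam u) (s - u) ^ p v ^ k` on `u ≤ s`, and zero elsewhere. -/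
noncomputable def truncatedWeight (lam s : ℝ) (p k : ℕ) (z : ℝ × ℝ) : ℝ :=
  if z.1 ≤ s then Real.exp (lam * z.1) * (s - z.1) ^ p * z.2 ^ k else 0

lemma measurable_truncatedWeight (lam s : ℝ) (p k : ℕ) : Measurable (truncatedWeight lam s p k) :=
  Measurable.ite (measurableSet_le measurable_fst measurable_const) (by fun_prop) measurable_const

lemma abs_truncatedWeight_le {lam : ℝ} (hlam : 0 < lam) (s : ℝ) (p k : ℕ) {z : ℝ × ℝ}
    (h0 : 0 ≤ z.1) (h1 : |z.2| ≤ z.1) :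
    ‖truncatedWeight lam s p k z‖ ≤ Real.exp (lam * |s|) * |s| ^ p * |s| ^ k := by
  rw [truncatedWeight]
  split_ifs with h
  · rw [Real.norm_eq_abs, abs_mul, abs_mul, Real.abs_exp, abs_pow, abs_pow]
    have h4 : s ≤ |s| := le_abs_self s
    have h2 : |s - z.1| ≤ |s| := by rw [abs_of_nonneg (by linarith)]; linarith
    have h3 : |z.2| ≤ |s| := by linarith
    exact mul_le_mul (mul_le_mul (Real.exp_le_exp.mpr (by gcongr; linarith))
      (pow_le_pow_left₀ (abs_nonneg _) h2 p) (by positivity) (by positivity))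
      (pow_le_pow_left₀ (abs_nonneg _) h3 k) (by positivity) (by positivity)
  · rw [norm_zero]; positivity

lemma integrable_truncatedWeight {lam : ℝ} (hlam : 0 < lam) (s : ℝ) (p k : ℕ)
    {ρ : Measure (ℝ × ℝ)} [IsFiniteMeasure ρ] (hρ : ∀ᵐ z ∂ρ, 0 ≤ z.1 ∧ |z.2| ≤ z.1) :
    Integrable (truncatedWeight lam s p k) ρ := by
  refine Integrable.of_bound (measurable_truncatedWeight _ _ _ _).aestronglyMeasurable
    (Real.exp (lam * |s|) * |s| ^ p * |s| ^ k) ?_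
  filter_upwards [hρ] with z hz using abs_truncatedWeight_le hlam s p k hz.1 hz.2

lemma integrable_cos_pow (κ : Measure ℝ) [IsFiniteMeasure κ] (i : ℕ) :
    Integrable (fun θ => Real.cos θ ^ i) κ := by
  refine Integrable.of_bound (by fun_prop) 1 (Filter.Eventually.of_forall fun θ => ?_)
  rw [norm_pow]
  exact pow_le_one₀ (norm_nonneg _) (Real.abs_cos_le_one _)

/-- The family of truncated weights is stable under one step of the walk: averaging over a gap and
an angle returns weights of the previous state. This closure is what makes the induction on the
number of events possible. -/
lemma integral_truncatedWeight_step {lam : ℝ} (hlam : 0 < lam) (s : ℝ) (p k : ℕ)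
    {ρ : Measure (ℝ × ℝ)} [IsProbabilityMeasure ρ] (hρ : ∀ᵐ z ∂ρ, 0 ≤ z.1 ∧ |z.2| ≤ z.1)
    {κ : Measure ℝ} [IsProbabilityMeasure κ] :
    ∫ z, truncatedWeight lam s p k (z.1.1 + z.2.1, z.1.2 + z.2.1 * Real.cos z.2.2)
      ∂(ρ.prod ((expMeasure lam).prod κ)) =
    ∑ ij ∈ Finset.HasAntidiagonal.antidiagonal k, (k.choose ij.1 : ℝ) * (∫ θ, Real.cos θ ^ ij.1 ∂κ) *
      (lam * (p.factorial * ij.1.factorial / (p + ij.1 + 1).factorial)) *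
      ∫ z, truncatedWeight lam s (p + ij.1 + 1) ij.2 z ∂ρ := by
  have := isProbabilityMeasure_expMeasure hlam
  have hq : ∀ᵐ z ∂((expMeasure lam).prod κ), 0 ≤ z.1 :=
    Measure.quasiMeasurePreserving_fst.ae (expMeasure_ae_nonneg lam)
  have hall : ∀ᵐ z ∂(ρ.prod ((expMeasure lam).prod κ)),
      (0 ≤ z.1.1 ∧ |z.1.2| ≤ z.1.1) ∧ 0 ≤ z.2.1 :=
    (Measure.quasiMeasurePreserving_fst.ae hρ).and (Measure.quasiMeasurePreserving_snd.ae hq)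
  have hint : Integrable (fun z : (ℝ × ℝ) × (ℝ × ℝ) => truncatedWeight lam s p k
      (z.1.1 + z.2.1, z.1.2 + z.2.1 * Real.cos z.2.2)) (ρ.prod ((expMeasure lam).prod κ)) := by
    refine Integrable.of_bound ((measurable_truncatedWeight _ _ _ _).comp
      (by fun_prop)).aestronglyMeasurable (Real.exp (lam * |s|) * |s| ^ p * |s| ^ k) ?_
    filter_upwards [hall] with z hz
    refine abs_truncatedWeight_le hlam s p k (by have := hz.1.1; have := hz.2; simp; linarith) ?_
    refine (abs_add_le _ _).trans (add_le_add hz.1.2 ?_)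
    rw [abs_mul, abs_of_nonneg hz.2]
    exact mul_le_of_le_one_right hz.2 (Real.abs_cos_le_one _)
  rw [integral_prod _ hint]
  have hinner : ∀ y : ℝ × ℝ, ∫ z, truncatedWeight lam s p k (y.1 + z.1, y.2 + z.1 * Real.cos z.2)
      ∂((expMeasure lam).prod κ) = ∑ ij ∈ Finset.HasAntidiagonal.antidiagonal k,
      (k.choose ij.1 : ℝ) * (∫ θ, Real.cos θ ^ ij.1 ∂κ) *
      (lam * (p.factorial * ij.1.factorial / (p + ij.1 + 1).factorial)) *
      truncatedWeight lam s (p + ij.1 + 1) ij.2 y := by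
    intro y
    -- The binomial expansion separates gap from angle, since `s - (u + e) = (s - u) - e` and the
    -- exponential factorises.
    have e : ∀ z : ℝ × ℝ, truncatedWeight lam s p k (y.1 + z.1, y.2 + z.1 * Real.cos z.2) =
        ∑ ij ∈ Finset.HasAntidiagonal.antidiagonal k, (Real.exp (lam * y.1) * k.choose ij.1 * y.2 ^ ij.2) *
          (truncatedGap lam (s - y.1) p ij.1 z.1 * Real.cos z.2 ^ ij.1) := by
      intro z
      simp only [truncatedWeight, truncatedGap]
      by_cases h : y.1 + z.1 ≤ s
      · rw [if_pos h, add_comm y.2, (Commute.all _ _).add_pow', Finset.mul_sum]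
        refine Finset.sum_congr rfl fun ij _ => ?_
        rw [if_pos (by linarith), mul_add, Real.exp_add, mul_pow, nsmul_eq_mul]
        ring
      · rw [if_neg h]
        refine (Finset.sum_eq_zero fun ij _ => ?_).symm
        rw [if_neg (by contrapose! h; linarith)]
        simp
    simp only [e]
    rw [integral_finsetSum]
    · refine Finset.sum_congr rfl fun ij _ => ?_
      rw [integral_const_mul,
        integral_prod_mul (truncatedGap lam (s - y.1) p ij.1) (fun θ => Real.cos θ ^ ij.1),
        integral_truncatedGap hlam, truncatedWeight]
      by_cases h : y.1 ≤ s
      · rw [if_pos (by linarith), if_pos h]; ring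
      · rw [if_neg (by linarith), if_neg h]; ring
    · intro ij _
      exact (Integrable.mul_prod (integrable_truncatedGap hlam _ _ _)
        (integrable_cos_pow κ ij.1)).const_mul _
  simp only [hinner]
  rw [integral_finsetSum]
  · simp only [integral_const_mul]
  · exact fun ij _ => (integrable_truncatedWeight hlam _ _ _ hρ).const_mul _

/-- `(v + (s - u) cos θ) ^ k` on `u ≤ s < u + e`, and zero elsewhere. -/
noncomputable def stoppedWeight (s : ℝ) (k : ℕ) (z : (ℝ × ℝ) × (ℝ × ℝ)) : ℝ :=
  if z.1.1 ≤ s ∧ s < z.1.1 + z.2.1 then (z.1.2 + (s - z.1.1) * Real.cos z.2.2) ^ k else 0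

lemma measurable_stoppedWeight (s : ℝ) (k : ℕ) : Measurable (stoppedWeight s k) :=
  have h1 : MeasurableSet {z : (ℝ × ℝ) × (ℝ × ℝ) | z.1.1 ≤ s} :=
    measurableSet_le (by fun_prop) (by fun_prop)
  have h2 : MeasurableSet {z : (ℝ × ℝ) × (ℝ × ℝ) | s < z.1.1 + z.2.1} :=
    measurableSet_lt (by fun_prop) (by fun_prop)
  Measurable.ite (h1.inter h2) (by fun_prop) measurable_const

/-- The last gap is cut at `s`. Its survival probability `exp (-(lam (s - u)))` supplies the factor
`exp (lam u)` in the truncated weight, and the elapsed time `s - u` supplies its power. -/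
lemma integral_stoppedWeight {lam : ℝ} (hlam : 0 < lam) (s : ℝ) (k : ℕ)
    {ρ : Measure (ℝ × ℝ)} [IsProbabilityMeasure ρ] (hρ : ∀ᵐ z ∂ρ, 0 ≤ z.1 ∧ |z.2| ≤ z.1)
    {κ : Measure ℝ} [IsProbabilityMeasure κ] :
    ∫ z, stoppedWeight s k z ∂(ρ.prod ((expMeasure lam).prod κ)) =
    ∑ ij ∈ Finset.HasAntidiagonal.antidiagonal k, (k.choose ij.1 : ℝ) * (∫ θ, Real.cos θ ^ ij.1 ∂κ) *
      Real.exp (-(lam * s)) * ∫ z, truncatedWeight lam s ij.1 ij.2 z ∂ρ := by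
  have := isProbabilityMeasure_expMeasure hlam
  have hint : Integrable (stoppedWeight s k) (ρ.prod ((expMeasure lam).prod κ)) := by
    refine Integrable.of_bound (measurable_stoppedWeight s k).aestronglyMeasurable (|s| ^ k) ?_
    filter_upwards [Measure.quasiMeasurePreserving_fst.ae hρ] with z hz
    rw [stoppedWeight]
    split_ifs with h
    · rw [norm_pow]
      gcongr
      refine (abs_add_le _ _).trans ?_
      rw [abs_mul, abs_of_nonneg (by linarith : 0 ≤ s - z.1.1)]
      have := mul_le_of_le_one_right (by linarith : 0 ≤ s - z.1.1) (Real.abs_cos_le_one z.2.2)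
      have := hz.2
      have := le_abs_self s
      linarith
    · rw [norm_zero]; positivity
  rw [integral_prod _ hint]
  have hinner : ∀ y : ℝ × ℝ, ∫ z, stoppedWeight s k (y, z) ∂((expMeasure lam).prod κ) =
      ∑ ij ∈ Finset.HasAntidiagonal.antidiagonal k, (k.choose ij.1 : ℝ) * (∫ θ, Real.cos θ ^ ij.1 ∂κ) *
      Real.exp (-(lam * s)) * truncatedWeight lam s ij.1 ij.2 y := by
    intro y
    by_cases h : y.1 ≤ s
    · have e : ∀ z : ℝ × ℝ, stoppedWeight s k (y, z) = ∑ ij ∈ Finset.HasAntidiagonal.antidiagonal k,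
          (k.choose ij.1 * (s - y.1) ^ ij.1 * y.2 ^ ij.2) *
            ((if s - y.1 < z.1 then (1 : ℝ) else 0) * Real.cos z.2 ^ ij.1) := by
        intro z
        simp only [stoppedWeight]
        by_cases h' : s < y.1 + z.1
        · rw [if_pos ⟨h, h'⟩, add_comm y.2, (Commute.all _ _).add_pow']
          refine Finset.sum_congr rfl fun ij _ => ?_
          rw [if_pos (by linarith), mul_pow, nsmul_eq_mul]
          ring
        · rw [if_neg (fun h2 => h' h2.2)]
          refine (Finset.sum_eq_zero fun ij _ => ?_).symm
          rw [if_neg (by contrapose! h'; linarith)]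
          simp
      simp only [e]
      rw [integral_finsetSum]
      · refine Finset.sum_congr rfl fun ij _ => ?_
        rw [integral_const_mul,
          integral_prod_mul (fun e => if s - y.1 < e then (1 : ℝ) else 0)
            (fun θ => Real.cos θ ^ ij.1),
          integral_expMeasure_tail hlam (by linarith), truncatedWeight, if_pos h,
          show -(lam * (s - y.1)) = -(lam * s) + lam * y.1 by ring, Real.exp_add]
        ring
      · intro ij _
        have h1 : Integrable (fun e : ℝ => if s - y.1 < e then (1 : ℝ) else 0)
            (expMeasure lam) := by
          refine Integrable.of_bound (Measurable.ite measurableSet_Ioi measurable_const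
            measurable_const).aestronglyMeasurable 1 (Filter.Eventually.of_forall fun e => ?_)
          split_ifs <;> simp
        exact (h1.mul_prod (integrable_cos_pow κ ij.1)).const_mul _
    · have e : ∀ z : ℝ × ℝ, stoppedWeight s k (y, z) = 0 := by
        intro z
        rw [stoppedWeight, if_neg fun h2 => h h2.1]
      simp [e, truncatedWeight, h]
  simp only [hinner]
  rw [integral_finsetSum]
  · simp only [integral_const_mul]
  · exact fun ij _ => (integrable_truncatedWeight hlam _ _ _ hρ).const_mul _

/-! ### Moments of the walk observed at event times -/

/-- The `n`-th event time together with the position (for unit speed) at that time. -/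
noncomputable def eventWalk {Ω : Type*} (S θ : ℕ → Ω → ℝ) (n : ℕ) (ω : Ω) : ℝ × ℝ :=
  (S n ω, ∑ j ∈ Finset.range n, (S (j + 1) ω - S j ω) * Real.cos (θ j ω))

/-- The waiting time following the `n`-th event together with the angle used during it. -/
def eventStep {Ω : Type*} (S θ : ℕ → Ω → ℝ) (n : ℕ) (ω : Ω) : ℝ × ℝ :=
  (S (n + 1) ω - S n ω, θ n ω)

lemma abs_eventWalk_le {Ω : Type*} {S θ : ℕ → Ω → ℝ} {n : ℕ} {ω : Ω} (h0 : S 0 ω = 0) (h : ∀ n, S n ω < S (n + 1) ω) :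
    0 ≤ (eventWalk S θ n ω).1 ∧ |(eventWalk S θ n ω).2| ≤ (eventWalk S θ n ω).1 := by
  have hm : Monotone fun n => S n ω := monotone_nat_of_le_succ fun n => (h n).le
  refine ⟨by simpa [eventWalk, h0] using hm (Nat.zero_le n), ?_⟩
  simp only [eventWalk]
  refine (Finset.abs_sum_le_sum_abs _ _).trans ?_
  calc ∑ j ∈ Finset.range n, |(S (j + 1) ω - S j ω) * Real.cos (θ j ω)|
      ≤ ∑ j ∈ Finset.range n, (S (j + 1) ω - S j ω) := by
        refine Finset.sum_le_sum fun j _ => ?_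
        have := h j
        rw [abs_mul, abs_of_pos (by linarith)]
        exact mul_le_of_le_one_right (by linarith) (Real.abs_cos_le_one _)
    _ = S n ω := by rw [Finset.sum_range_sub (fun j => S j ω), h0, sub_zero]

namespace IsFrictionMotion

variable {Ω : Type*} [MeasurableSpace Ω] {P : Measure Ω} {lam ν : ℝ}
  {S θ : ℕ → Ω → ℝ}

lemma measurable_eventWalk (hX : IsFrictionMotion P lam ν S θ) (n : ℕ) :
    Measurable (eventWalk S θ n) := by
  have := hX.measurable_time
  have := hX.measurable_angle
  unfold eventWalk
  fun_prop

lemma measurable_eventStep (hX : IsFrictionMotion P lam ν S θ) (n : ℕ) :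
    Measurable (eventStep S θ n) := by
  have := hX.measurable_time
  have := hX.measurable_angle
  unfold eventStep
  fun_prop

lemma ae_gap_pos (hX : IsFrictionMotion P lam ν S θ) :
    ∀ᵐ ω ∂P, ∀ n, S n ω < S (n + 1) ω := by
  rw [ae_all_iff]
  intro n
  have h := expMeasure_ae_pos lam
  rw [← (hX.gap_law n).map_eq] at h
  filter_upwards [ae_of_ae_map (hX.gap_law n).aemeasurable h] with ω hω
  linarith

lemma ae_map_walk (hX : IsFrictionMotion P lam ν S θ) (n : ℕ) :
    ∀ᵐ z ∂(P.map (eventWalk S θ n)), 0 ≤ z.1 ∧ |z.2| ≤ z.1 := by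
  have hmeas : MeasurableSet {z : ℝ × ℝ | 0 ≤ z.1 ∧ |z.2| ≤ z.1} :=
    (measurableSet_le measurable_const measurable_fst).inter
      (measurableSet_le (by fun_prop) measurable_fst)
  rw [ae_map_iff (hX.measurable_eventWalk n).aemeasurable hmeas]
  filter_upwards [hX.ae_gap_pos] with ω hω using abs_eventWalk_le (hX.start_zero ω) hω

variable [IsProbabilityMeasure P]

lemma indep_walk_step (hX : IsFrictionMotion P lam ν S θ) (n : ℕ) :
    IndepFun (eventWalk S θ n) (eventStep S θ n) P := by
  have mS := hX.measurable_time
  have mθ := hX.measurable_angle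
  have hdisj : Disjoint (Finset.range n) {n} := by simp
  have h1 := hX.gap_indep.indepFun_finset (Finset.range n) {n} hdisj (fun i => by fun_prop)
  have h2 := hX.angle_indep.indepFun_finset (Finset.range n) {n} hdisj mθ
  have h1' := h1.comp measurable_id (measurable_pi_apply (⟨n, by simp⟩ : ({n} : Finset ℕ)))
  have h2' := h2.comp measurable_id (measurable_pi_apply (⟨n, by simp⟩ : ({n} : Finset ℕ)))
  have h3 := hX.indep.comp
    (φ := fun x : ℕ → ℝ => ((fun i : Finset.range n => x (i + 1) - x i), x (n + 1) - x n))
    (ψ := fun x : ℕ → ℝ => ((fun i : Finset.range n => x i), x n)) (by fun_prop) (by fun_prop)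
  have h4 := IndepFun.prodMk_prodMk_comm (by fun_prop) (by fun_prop) (by fun_prop) (by fun_prop)
    h1' h2' h3
  have h5 := h4.comp (φ := fun x : (Finset.range n → ℝ) × (Finset.range n → ℝ) =>
    (∑ j, x.1 j, ∑ j, x.1 j * Real.cos (x.2 j))) (ψ := id) (by fun_prop) measurable_id
  suffices e : eventWalk S θ n = (fun x : (Finset.range n → ℝ) × (Finset.range n → ℝ) =>
    (∑ j, x.1 j, ∑ j, x.1 j * Real.cos (x.2 j))) ∘ fun ω =>
      ((id ∘ fun a (i : Finset.range n) => S (i + 1) a - S i a) ω,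
        (id ∘ fun a (i : Finset.range n) => θ i a) ω) by
    rw [e]
    exact h5
  ext ω
  · simp only [eventWalk, Function.comp_apply, id_eq]
    rw [Finset.sum_coe_sort (Finset.range n) (fun j => S (j + 1) ω - S j ω),
      Finset.sum_range_sub (fun j => S j ω), hX.start_zero, sub_zero]
  · simp only [eventWalk, Function.comp_apply, id_eq]
    rw [Finset.sum_coe_sort (Finset.range n) (fun j => (S (j + 1) ω - S j ω) * Real.cos (θ j ω))]

lemma hasLaw_eventStep (hX : IsFrictionMotion P lam ν S θ) (n : ℕ) :
    HasLaw (eventStep S θ n) ((expMeasure lam).prod (frictionAngleLaw ν)) P := by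
  refine IndepFun.hasLaw_prod (hX.gap_law n) (hX.angle_law n) ?_
  exact hX.indep.comp (φ := fun x : ℕ → ℝ => x (n + 1) - x n) (ψ := fun x : ℕ → ℝ => x n)
    (by fun_prop) (by fun_prop)

lemma isProbabilityMeasure_angleLaw (hX : IsFrictionMotion P lam ν S θ) :
    IsProbabilityMeasure (frictionAngleLaw ν) := by
  rw [← (hX.angle_law 0).map_eq]
  exact Measure.isProbabilityMeasure_map (hX.angle_law 0).aemeasurable

lemma hasLaw_walk_step (hX : IsFrictionMotion P lam ν S θ) (n : ℕ) :
    HasLaw (fun ω => (eventWalk S θ n ω, eventStep S θ n ω))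
      ((P.map (eventWalk S θ n)).prod ((expMeasure lam).prod (frictionAngleLaw ν))) P :=
  IndepFun.hasLaw_prod ⟨(hX.measurable_eventWalk n).aemeasurable, rfl⟩ (hX.hasLaw_eventStep n)
    (hX.indep_walk_step n)

/-- Each step adds one binomial convolution with the angle moments. The factorials from the beta
integrals cancel the binomial coefficients, so the convolution becomes a product of ordinary
generating series. -/
lemma integral_truncatedWeight_walk (hX : IsFrictionMotion P lam ν S θ) (hlam : 0 < lam)
    (hν : ∀ k, ∫ x, Real.cos x ^ k ∂(frictionAngleLaw ν) = frictionMoment ν k)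
    {s : ℝ} (hs : 0 ≤ s) (n p k : ℕ) :
    ∫ z, truncatedWeight lam s p k z ∂(P.map (eventWalk S θ n)) =
      lam ^ n * (p.factorial * k.factorial / (p + k + n).factorial) * s ^ (p + k + n) *
        PowerSeries.coeff k (momentSeries ν ^ n) := by
  have := hX.isProbabilityMeasure_angleLaw
  induction n generalizing p k with
  | zero =>
    rw [integral_map (hX.measurable_eventWalk 0).aemeasurable
      (measurable_truncatedWeight _ _ _ _).aestronglyMeasurable]
    have e : ∀ ω, truncatedWeight lam s p k (eventWalk S θ 0 ω) = s ^ p * 0 ^ k := by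
      intro ω
      simp [truncatedWeight, eventWalk, hX.start_zero, hs]
    simp only [e, integral_const, probReal_univ, smul_eq_mul, pow_zero, PowerSeries.coeff_one]
    rcases k with _ | k
    · simp
      field_simp
    · simp
  | succ n ih =>
    have := Measure.isProbabilityMeasure_map (μ := P) (hX.measurable_eventWalk n).aemeasurable
    have hstep := integral_truncatedWeight_step hlam s p k (hX.ae_map_walk n)
      (κ := frictionAngleLaw ν)
    rw [← (hX.hasLaw_walk_step n).map_eq, integral_map
      ((hX.measurable_eventWalk n).prodMk (hX.measurable_eventStep n)).aemeasurable
      (((measurable_truncatedWeight lam s p k).comp (g := truncatedWeight lam s p k)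
        (f := fun z : (ℝ × ℝ) × (ℝ × ℝ) => (z.1.1 + z.2.1, z.1.2 + z.2.1 * Real.cos z.2.2))
        (by fun_prop)).aestronglyMeasurable : AEStronglyMeasurable (fun z => truncatedWeight lam s p k
          (z.1.1 + z.2.1, z.1.2 + z.2.1 * Real.cos z.2.2)) _)] at hstep
    rw [integral_map (hX.measurable_eventWalk (n + 1)).aemeasurable
      (measurable_truncatedWeight _ _ _ _).aestronglyMeasurable]
    have e : ∀ ω, eventWalk S θ (n + 1) ω = ((eventWalk S θ n ω).1 + (eventStep S θ n ω).1,
        (eventWalk S θ n ω).2 + (eventStep S θ n ω).1 * Real.cos (eventStep S θ n ω).2) := by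
      intro ω
      simp [eventWalk, eventStep, Finset.sum_range_succ]
    simp only [e]
    rw [hstep, pow_succ' (momentSeries ν), PowerSeries.coeff_mul, Finset.mul_sum]
    refine Finset.sum_congr rfl fun ij hij => ?_
    have hk := Finset.HasAntidiagonal.mem_antidiagonal.mp hij
    rw [ih, hν, show p + ij.1 + 1 + ij.2 + n = p + k + (n + 1) by omega]
    have hc : ((k.choose ij.1 : ℕ) : ℝ) * ij.1.factorial * ij.2.factorial = k.factorial := by
      have := Nat.choose_mul_factorial_mul_factorial (show ij.1 ≤ k by omega)
      rw [show k - ij.1 = ij.2 by omega] at this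
      exact_mod_cast this
    rw [← hc]
    simp only [momentSeries, PowerSeries.coeff_mk]
    field_simp
    ring

lemma integral_stoppedWeight_walk (hX : IsFrictionMotion P lam ν S θ) (hlam : 0 < lam)
    (hν : ∀ k, ∫ x, Real.cos x ^ k ∂(frictionAngleLaw ν) = frictionMoment ν k)
    {s : ℝ} (hs : 0 ≤ s) (n k : ℕ) :
    ∫ ω, stoppedWeight s k (eventWalk S θ n ω, eventStep S θ n ω) ∂P =
      Real.exp (-(lam * s)) * lam ^ n * (k.factorial / (n + k).factorial) * s ^ (n + k) *
        PowerSeries.coeff k (momentSeries ν ^ (n + 1)) := by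
  have := hX.isProbabilityMeasure_angleLaw
  have := Measure.isProbabilityMeasure_map (μ := P) (hX.measurable_eventWalk n).aemeasurable
  have hstep := integral_stoppedWeight hlam s k (hX.ae_map_walk n) (κ := frictionAngleLaw ν)
  rw [← (hX.hasLaw_walk_step n).map_eq, integral_map
      ((hX.measurable_eventWalk n).prodMk (hX.measurable_eventStep n)).aemeasurable
      (measurable_stoppedWeight _ _).aestronglyMeasurable] at hstep
  rw [hstep, pow_succ' (momentSeries ν), PowerSeries.coeff_mul, Finset.mul_sum]
  refine Finset.sum_congr rfl fun ij hij => ?_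
  have hk := Finset.HasAntidiagonal.mem_antidiagonal.mp hij
  rw [hX.integral_truncatedWeight_walk hlam hν hs, hν, show ij.1 + ij.2 + n = n + k by omega]
  have hc : ((k.choose ij.1 : ℕ) : ℝ) * ij.1.factorial * ij.2.factorial = k.factorial := by
    have := Nat.choose_mul_factorial_mul_factorial (show ij.1 ≤ k by omega)
    rw [show k - ij.1 = ij.2 by omega] at this
    exact_mod_cast this
  rw [← hc]
  simp only [momentSeries, PowerSeries.coeff_mk]
  field_simp

end IsFrictionMotion

/-! ### Moments of the position at a fixed time -/

lemma eventCount_eq_iff {Ω : Type*} {S : ℕ → Ω → ℝ} {ω : Ω} (h : ∀ n, S n ω < S (n + 1) ω)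
    (s : ℝ) {n : ℕ} (hn : 1 ≤ n) : eventCount S s ω = n ↔ S n ω ≤ s ∧ s < S (n + 1) ω := by
  have hm : StrictMono fun n => S n ω := strictMono_nat_of_lt_succ h
  have key : ∀ n : ℕ, (S n ω ≤ s ∨ n = 0) → s < S (n + 1) ω → eventCount S s ω = n := by
    intro n h1 h2
    have e : {k : ℕ | 1 ≤ k ∧ S k ω ≤ s} = Set.Icc 1 n := by
      ext k
      simp only [Set.mem_ofPred_eq, Set.mem_Icc, and_congr_right_iff]
      intro hk
      constructor
      · intro h3
        by_contra h4
        have := hm.monotone (show n + 1 ≤ k by omega)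
        linarith [this, h2, h3]
      · intro h3
        rcases h1 with h1 | h1
        · exact (hm.monotone h3).trans h1
        · omega
    rw [eventCount, e, ← Finset.coe_Icc, Set.ncard_coe_finset]
    simp
  refine ⟨fun hcount => ?_, fun ⟨h1, h2⟩ => key n (Or.inl h1) h2⟩
  by_cases hall : ∃ k, s < S (k + 1) ω
  · classical
    have hN := Nat.find_spec hall
    have hmin := fun j => Nat.find_min (H := hall) (m := j)
    set N := Nat.find hall
    have h1 : S N ω ≤ s ∨ N = 0 := by
      rcases Nat.eq_zero_or_pos N with h0 | h0
      · exact Or.inr h0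
      · left
        have := hmin (N - 1) (by omega)
        rw [Nat.sub_add_cancel h0] at this
        exact not_lt.mp this
    have h2 := key N h1 hN
    have h3 : n = N := by rw [← hcount, h2]
    rw [h3]
    refine ⟨h1.resolve_right (by omega), hN⟩
  -- If all event times are at most `s`, the set counted is infinite and `Set.ncard` returns `0`;
  -- this is excluded by `1 ≤ n`.
  · push Not at hall
    have e : {k : ℕ | 1 ≤ k ∧ S k ω ≤ s} = Set.Ici 1 := by
      ext k
      simp only [Set.mem_ofPred_eq, Set.mem_Ici, and_iff_left_iff_imp]
      intro hk
      have := hall (k - 1)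
      rwa [Nat.sub_add_cancel hk] at this
    rw [eventCount, e, (Set.Ici_infinite 1).ncard] at hcount
    omega

lemma frictionPosition_eq {Ω : Type*} {S θ : ℕ → Ω → ℝ} (c s : ℝ) {ω : Ω} {n : ℕ}
    (h : eventCount S s ω = n) : frictionPosition c S θ s ω =
      c * ((eventWalk S θ n ω).2 + (s - S n ω) * Real.cos (θ n ω)) := by
  rw [frictionPosition, h, Finset.sum_range_succ, if_pos rfl, eventWalk]
  congr 2
  refine Finset.sum_congr rfl fun j hj => ?_
  rw [if_neg (Finset.mem_range.mp hj).ne]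

lemma eventPosition_pow_eq_stoppedWeight {Ω : Type*} {S θ : ℕ → Ω → ℝ} {ω : Ω}
    (h : ∀ n, S n ω < S (n + 1) ω) (c s : ℝ) {n : ℕ} (hn : 1 ≤ n) (k : ℕ) :
    (if eventCount S s ω = n then frictionPosition c S θ s ω ^ k else 0) =
      c ^ k * stoppedWeight s k (eventWalk S θ n ω, eventStep S θ n ω) := by
  rw [stoppedWeight]
  have e : (eventWalk S θ n ω).1 + (eventStep S θ n ω).1 = S (n + 1) ω := by
    simp [eventWalk, eventStep]
  by_cases hc : eventCount S s ω = n
  · rw [if_pos hc, frictionPosition_eq c s hc, mul_pow]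
    simp only [e]
    rw [if_pos]
    · rfl
    · exact (eventCount_eq_iff h s hn).mp hc
  · simp only [e]
    rw [if_neg hc, if_neg, mul_zero]
    exact fun h2 => hc ((eventCount_eq_iff h s hn).mpr h2)

lemma abs_frictionPosition_le {Ω : Type*} {S θ : ℕ → Ω → ℝ} {ω : Ω} (h0 : S 0 ω = 0)
    (h : ∀ n, S n ω < S (n + 1) ω) {c : ℝ} (hc : 0 ≤ c) (s : ℝ) {n : ℕ} (hn : 1 ≤ n)
    (hcount : eventCount S s ω = n) : |frictionPosition c S θ s ω| ≤ c * |s| := by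
  rw [frictionPosition_eq c s hcount, abs_mul, abs_of_nonneg hc]
  refine mul_le_mul_of_nonneg_left ?_ hc
  have h1 := (abs_eventWalk_le (θ := θ) (n := n) h0 h).2
  have h2 := ((eventCount_eq_iff h s hn).mp hcount).1
  have h3 := mul_le_of_le_one_right (by linarith : 0 ≤ s - S n ω) (Real.abs_cos_le_one (θ n ω))
  refine (abs_add_le _ _).trans ?_
  rw [abs_mul, abs_of_nonneg (by linarith : 0 ≤ s - S n ω)]
  have h4 : (eventWalk S θ n ω).1 = S n ω := rfl
  have := le_abs_self s
  linarith

/-- The binomial coefficient in `coeff_momentSeries_pow` turns `k! / (n + k)!` into `1 / n!`, so the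
Poisson probability factors out and the rest is the conditional moment. -/
theorem integral_eventPosition_pow {Ω : Type*} [MeasurableSpace Ω] {P : Measure Ω}
    [IsProbabilityMeasure P] {lam : ℝ} {m : Fin 2} {S θ : ℕ → Ω → ℝ}
    (hX : IsFrictionMotion P lam ((m : ℕ) : ℝ) S θ) (hlam : 0 < lam) (c : ℝ) {s : ℝ} (hs : 0 ≤ s)
    {n : ℕ} (hn : 1 ≤ n) (k : ℕ) :
    ∫ ω, (if eventCount S s ω = n then frictionPosition c S θ s ω ^ k else 0) ∂P =
      Real.exp (-(lam * s)) * (lam * s) ^ n / n.factorial * (c * s) ^ k *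
        frictionMoment (motionIndex m n) k := by
  have h := hX.integral_stoppedWeight_walk hlam (integral_cos_pow_frictionAngleLaw m) hs n k
  rw [integral_congr_ae (g := fun ω => c ^ k *
    stoppedWeight s k (eventWalk S θ n ω, eventStep S θ n ω)) (by
      filter_upwards [hX.ae_gap_pos] with ω hω using
        eventPosition_pow_eq_stoppedWeight hω c s hn k),
    integral_const_mul, h, coeff_momentSeries_pow,
    Nat.cast_choose ℝ (Nat.le_add_left k n), Nat.add_sub_cancel]
  field_simp
  ring

/-! ### Determination of a measure by its moments -/

section MomentProblem

variable {μ ν : Measure ℝ}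

/-- The series of `cosh` has nonnegative terms, so Tonelli applies even when the integral is
infinite. Hence integrability of `cosh` depends on the even moments only and passes between measures
with equal moments. -/
lemma lintegral_cosh_mul (hμ : ∀ k : ℕ, Integrable (fun x => x ^ k) μ) (u : ℝ) :
    ∫⁻ x, ENNReal.ofReal (Real.cosh (u * x)) ∂μ =
      ∑' k : ℕ, ENNReal.ofReal (u ^ (2 * k) / (2 * k).factorial * ∫ x, x ^ (2 * k) ∂μ) := by
  have h : ∀ x : ℝ, ENNReal.ofReal (Real.cosh (u * x)) =
      ∑' k : ℕ, ENNReal.ofReal (u ^ (2 * k) / (2 * k).factorial * x ^ (2 * k)) := by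
    intro x
    have hs := Real.hasSum_cosh (u * x)
    rw [← hs.tsum_eq, ENNReal.ofReal_tsum_of_nonneg _ hs.summable]
    · refine tsum_congr fun k => ?_
      rw [mul_pow]
      ring_nf
    · intro k
      rw [pow_mul]
      positivity
  simp only [h]
  rw [lintegral_tsum fun k => by fun_prop]
  refine tsum_congr fun k => ?_
  rw [← integral_const_mul, ofReal_integral_eq_lintegral_ofReal ((hμ _).const_mul _)]
  refine Filter.Eventually.of_forall fun x => ?_
  simp only [Pi.zero_apply]
  rw [pow_mul, pow_mul]
  positivity

lemma integrable_cosh_of_moments_eq (hμ : ∀ k : ℕ, Integrable (fun x => x ^ k) μ)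
    (hν : ∀ k : ℕ, Integrable (fun x => x ^ k) ν)
    (h : ∀ k : ℕ, ∫ x, x ^ k ∂μ = ∫ x, x ^ k ∂ν) {u : ℝ}
    (hexp : Integrable (fun x => Real.cosh (u * x)) ν) :
    Integrable (fun x => Real.cosh (u * x)) μ := by
  have hpos : ∀ {ρ : Measure ℝ}, 0 ≤ᵐ[ρ] fun x => Real.cosh (u * x) :=
    Filter.Eventually.of_forall fun x => (Real.cosh_pos _).le
  have hm : Measurable fun x : ℝ => Real.cosh (u * x) :=
    Real.continuous_cosh.measurable.comp (by fun_prop)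
  rw [← lintegral_ofReal_ne_top_iff_integrable hm.aestronglyMeasurable hpos] at hexp ⊢
  rw [lintegral_cosh_mul hμ]
  rw [lintegral_cosh_mul hν] at hexp
  simpa only [h] using hexp

/-- The exponential series is integrated termwise, dominated by `exp |ξ x| ≤ 2 cosh (ξ x)`. -/
lemma hasSum_charFun_of_integrable_cosh (hexp : ∀ u : ℝ, Integrable (fun x => Real.cosh (u * x)) μ)
    (ξ : ℝ) :
    HasSum (fun k : ℕ => ((ξ * Complex.I) ^ k / k.factorial) * ((∫ x, x ^ k ∂μ : ℝ) : ℂ))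
      (charFun μ ξ) := by
  rw [charFun_apply_real]
  have hsum : ∀ x : ℝ, HasSum (fun k : ℕ => |ξ * x| ^ k / k.factorial) (Real.exp |ξ * x|) := by
    intro x
    rw [Real.exp_eq_exp_ℝ]
    exact NormedSpace.expSeries_div_hasSum_exp _
  have hI : Integrable (fun x => Real.exp |ξ * x|) μ := by
    refine ((hexp ξ).const_mul 2).mono' (by fun_prop) (Filter.Eventually.of_forall fun x => ?_)
    rw [Real.norm_eq_abs, Real.abs_exp, Real.cosh_eq]
    rcases abs_cases (ξ * x) with ⟨h, -⟩ | ⟨h, -⟩ <;> rw [h] <;>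
      linarith [Real.exp_pos (ξ * x), Real.exp_pos (-(ξ * x))]
  have h := hasSum_integral_of_dominated_convergence (μ := μ)
    (F := fun (k : ℕ) (x : ℝ) => ((ξ * Complex.I) ^ k / k.factorial) * ((x ^ k : ℝ) : ℂ))
    (f := fun x : ℝ => Complex.exp (ξ * x * Complex.I))
    (fun k x => |ξ * x| ^ k / k.factorial) (fun k => by fun_prop) ?_ ?_ ?_ ?_
  · simp only [integral_const_mul] at h
    have e : ∀ k : ℕ, ((∫ x, x ^ k ∂μ : ℝ) : ℂ) = ∫ x, ((x ^ k : ℝ) : ℂ) ∂μ :=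
      fun k => integral_ofReal.symm
    simpa only [e] using h
  · intro k
    refine Filter.Eventually.of_forall fun x => le_of_eq ?_
    simp [abs_mul, mul_pow]
    ring
  · exact Filter.Eventually.of_forall fun x => (hsum x).summable
  · simpa only [(hsum _).tsum_eq] using hI
  · refine Filter.Eventually.of_forall fun x => ?_
    rw [Complex.exp_eq_exp_ℂ]
    have h := NormedSpace.expSeries_div_hasSum_exp (ξ * x * Complex.I : ℂ)
    have e : (fun k : ℕ => (ξ * x * Complex.I : ℂ) ^ k / k.factorial) =
        fun k : ℕ => ((ξ * Complex.I) ^ k / k.factorial) * ((x ^ k : ℝ) : ℂ) := by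
      ext k
      push_cast
      ring
    rwa [e] at h

/-- A measure with all exponential moments is determined by its moments. -/
theorem MeasureTheory.Measure.ext_of_moments_of_integrable_cosh [IsFiniteMeasure μ]
    [IsFiniteMeasure ν] (hμ : ∀ k : ℕ, Integrable (fun x => x ^ k) μ)
    (hν : ∀ k : ℕ, Integrable (fun x => x ^ k) ν)
    (h : ∀ k : ℕ, ∫ x, x ^ k ∂μ = ∫ x, x ^ k ∂ν)
    (hexp : ∀ u : ℝ, Integrable (fun x => Real.cosh (u * x)) ν) : μ = ν := by
  refine Measure.ext_of_charFun (funext fun ξ => ?_)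
  have h1 := hasSum_charFun_of_integrable_cosh
    (fun u => integrable_cosh_of_moments_eq hμ hν h (hexp u)) ξ
  have h2 := hasSum_charFun_of_integrable_cosh hexp ξ
  simp only [h] at h1
  exact h1.unique h2

end MomentProblem

/-! ### Normal, chi-squared and beta moments -/

/-- The moments of the standard normal law. -/
def normalMoment : ℕ → ℝ
  | 0 => 1
  | 1 => 0
  | k + 2 => (k + 1) * normalMoment k

lemma normalMoment_odd (j : ℕ) : normalMoment (2 * j + 1) = 0 := by
  induction j with
  | zero => simp [normalMoment]
  | succ j ih => rw [show 2 * (j + 1) + 1 = (2 * j + 1) + 2 by ring, normalMoment, ih, mul_zero]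

lemma integrable_pow_mul_exp_neg_sq (k : ℕ) :
    Integrable fun x : ℝ => x ^ k * Real.exp (-(1 / 2) * x ^ 2) := by
  have := integrable_rpow_mul_exp_neg_mul_sq (b := 1 / 2) (by norm_num) (s := (k : ℝ))
    (lt_of_lt_of_le (by norm_num) (Nat.cast_nonneg k))
  simpa only [Real.rpow_natCast] using this

lemma gaussianPDFReal_zero_one (x : ℝ) : gaussianPDFReal 0 1 x =
    (Real.sqrt (2 * Real.pi))⁻¹ * Real.exp (-(1 / 2) * x ^ 2) := by
  rw [gaussianPDFReal_def]
  simp only [sub_zero, NNReal.coe_one, mul_one]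
  ring_nf

lemma integrable_pow_gaussianReal (k : ℕ) : Integrable (fun x => x ^ k) (gaussianReal 0 1) := by
  rw [gaussianReal_of_var_ne_zero 0 one_ne_zero,
    integrable_withDensity_iff_integrable_smul' (measurable_gaussianPDF 0 1)
      (Filter.Eventually.of_forall fun x => ENNReal.ofReal_lt_top)]
  refine ((integrable_pow_mul_exp_neg_sq k).const_mul (Real.sqrt (2 * Real.pi))⁻¹).congr
    (Filter.Eventually.of_forall fun x => ?_)
  simp only [smul_eq_mul, toReal_gaussianPDF, gaussianPDFReal_zero_one]
  ring

lemma integral_pow_gaussianReal (k : ℕ) : ∫ x, x ^ k ∂(gaussianReal 0 1) = normalMoment k := by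
  have hI : ∀ k : ℕ, ∫ x, x ^ k ∂(gaussianReal 0 1) = (Real.sqrt (2 * Real.pi))⁻¹ *
      ∫ x : ℝ, x ^ k * Real.exp (-(1 / 2) * x ^ 2) := by
    intro k
    rw [integral_gaussianReal_eq_integral_smul one_ne_zero, ← integral_const_mul]
    refine integral_congr_ae (Filter.Eventually.of_forall fun x => ?_)
    simp only [smul_eq_mul, gaussianPDFReal_zero_one]
    ring
  have hd : ∀ (k : ℕ) (x : ℝ), HasDerivAt (fun x : ℝ => x ^ k * Real.exp (-(1 / 2) * x ^ 2))
      (k * x ^ (k - 1) * Real.exp (-(1 / 2) * x ^ 2) -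
        x ^ (k + 1) * Real.exp (-(1 / 2) * x ^ 2)) x := by
    intro k x
    have h1 := (hasDerivAt_pow k x).mul (((hasDerivAt_pow 2 x).const_mul (-(1 / 2 : ℝ))).exp)
    refine h1.congr_deriv ?_
    simp only [Nat.cast_ofNat]
    ring
  have hstep : ∀ k : ℕ, k * ∫ x : ℝ, x ^ (k - 1) * Real.exp (-(1 / 2) * x ^ 2) =
      ∫ x : ℝ, x ^ (k + 1) * Real.exp (-(1 / 2) * x ^ 2) := by
    intro k
    have i1 := (integrable_pow_mul_exp_neg_sq (k - 1)).const_mul (k : ℝ)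
    simp only [← mul_assoc] at i1
    have i2 := integrable_pow_mul_exp_neg_sq (k + 1)
    have h := integral_eq_zero_of_hasDerivAt_of_integrable (hd k) (i1.sub i2)
      (integrable_pow_mul_exp_neg_sq k)
    rw [integral_sub i1 i2, sub_eq_zero] at h
    rw [← h, ← integral_const_mul]
    simp only [mul_assoc]
  induction k using Nat.twoStepInduction with
  | zero => simp [normalMoment]
  | one =>
    have h := hstep 0
    rw [Nat.cast_zero, zero_mul, zero_add] at h
    rw [hI, ← h, mul_zero, normalMoment]
  | more k ih _ =>
    have h := hstep (k + 1)
    rw [hI, show k + 2 = (k + 1) + 1 from rfl, ← h, normalMoment, ← ih, hI]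
    rw [Nat.add_sub_cancel]
    push_cast
    ring

/-- The moments `d (d + 2) ⋯ (d + 2 (j - 1))` of the chi-squared law with `d` degrees of freedom. -/
def chiSqMoment (d : ℝ) (j : ℕ) : ℝ := ∏ i ∈ Finset.range j, (d + 2 * i)

lemma chiSqMoment_succ (d : ℝ) (j : ℕ) :
    chiSqMoment d (j + 1) = chiSqMoment d j * (d + 2 * j) := Finset.prod_range_succ _ _

lemma chiSqMoment_one (j : ℕ) : chiSqMoment 1 j = normalMoment (2 * j) := by
  induction j with
  | zero => simp [chiSqMoment, normalMoment]
  | succ j ih =>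
    rw [chiSqMoment_succ, ih, show 2 * (j + 1) = 2 * j + 2 by ring, normalMoment]
    push_cast
    ring

/-- A Vandermonde identity for rising products of step `2`. In the induction the new factor `a + b +
2 k` splits as `(a + 2 i) + (b + 2 j)` with `i + j = k`. -/
lemma chiSqMoment_add (a b : ℝ) (k : ℕ) : chiSqMoment (a + b) k =
    ∑ ij ∈ Finset.HasAntidiagonal.antidiagonal k,
      (k.choose ij.1 : ℝ) * (chiSqMoment a ij.1 * chiSqMoment b ij.2) := by
  induction k with
  | zero => simp [chiSqMoment]
  | succ k ih =>
    rw [Finset.sum_antidiagonal_choose_succ_mul (fun i j => chiSqMoment a i * chiSqMoment b j),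
      ← Finset.sum_add_distrib, chiSqMoment_succ, ih, Finset.sum_mul]
    refine Finset.sum_congr rfl fun ij hij => ?_
    have hk := Finset.HasAntidiagonal.mem_antidiagonal.mp hij
    rw [← Nat.choose_symm (show ij.2 ≤ k by omega), show k - ij.2 = ij.1 by omega,
      chiSqMoment_succ, chiSqMoment_succ, ← hk]
    push_cast
    ring

lemma integral_sum_sq_pow {Ω ι : Type*} [MeasurableSpace Ω] {P : Measure Ω}
    [IsProbabilityMeasure P] {X : ι → Ω → ℝ} (hm : ∀ i, Measurable (X i)) (hX : iIndepFun X P)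
    {v : ℝ} (hint : ∀ i k, Integrable (fun ω => X i ω ^ (2 * k)) P)
    (hmom : ∀ i k, ∫ ω, X i ω ^ (2 * k) ∂P = v ^ k * chiSqMoment 1 k) (s : Finset ι) (k : ℕ) :
    Integrable (fun ω => (∑ i ∈ s, X i ω ^ 2) ^ k) P ∧
      ∫ ω, (∑ i ∈ s, X i ω ^ 2) ^ k ∂P = v ^ k * chiSqMoment s.card k := by
  classical
  induction s using Finset.induction_on generalizing k with
  | empty =>
    rcases k with _ | k
    · simp [chiSqMoment]
    · simp [chiSqMoment, Finset.prod_range_succ']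
  | insert a s ha ih =>
    have hind : IndepFun (fun ω => ∑ i ∈ s, X i ω ^ 2) (fun ω => X a ω ^ 2) P := by
      have h1 := hX.comp (fun _ x => x ^ 2) (fun _ => by fun_prop)
      have h2 := h1.indepFun_finsetSum_of_notMem (fun i => by fun_prop) ha
      have e : (fun ω => ∑ i ∈ s, X i ω ^ 2) = ∑ j ∈ s, (fun x : ℝ => x ^ 2) ∘ X j := by
        ext ω
        simp
      rw [e]
      exact h2
    have hterm : ∀ i j : ℕ, Integrable (fun ω => (X a ω ^ 2) ^ i * (∑ i ∈ s, X i ω ^ 2) ^ j) P ∧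
        ∫ ω, (X a ω ^ 2) ^ i * (∑ i ∈ s, X i ω ^ 2) ^ j ∂P =
          v ^ (i + j) * (chiSqMoment 1 i * chiSqMoment s.card j) := by
      intro i j
      have h := hind.symm.comp (φ := fun x : ℝ => x ^ i) (ψ := fun x : ℝ => x ^ j)
        (by fun_prop) (by fun_prop)
      have hi := hint a i
      have hi2 := hmom a i
      simp only [pow_mul] at hi hi2
      refine ⟨h.integrable_mul hi (ih j).1, ?_⟩
      have h2 := h.integral_mul_eq_mul_integral hi.aestronglyMeasurable (ih j).1.aestronglyMeasurable
      simp only [Pi.mul_apply, Function.comp_apply] at h2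
      rw [h2, (ih j).2, hi2]
      ring
    have e : ∀ ω, (∑ i ∈ insert a s, X i ω ^ 2) ^ k =
        ∑ ij ∈ Finset.HasAntidiagonal.antidiagonal k,
          (k.choose ij.1 : ℝ) * ((X a ω ^ 2) ^ ij.1 * (∑ i ∈ s, X i ω ^ 2) ^ ij.2) := by
      intro ω
      rw [Finset.sum_insert ha, (Commute.all _ _).add_pow']
      simp only [nsmul_eq_mul]
    simp only [e]
    refine ⟨integrable_finsetSum _ fun ij _ => (hterm _ _).1.const_mul _, ?_⟩
    rw [integral_finsetSum _ fun ij _ => (hterm _ _).1.const_mul _, Finset.card_insert_of_notMem ha,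
      Nat.cast_add, Nat.cast_one, add_comm, chiSqMoment_add, Finset.mul_sum]
    refine Finset.sum_congr rfl fun ij hij => ?_
    have hk := Finset.HasAntidiagonal.mem_antidiagonal.mp hij
    rw [integral_const_mul, (hterm _ _).2, hk]
    ring

/-- The moments of the beta law with parameters `p`, `q`, where `r = p + q`. -/
noncomputable def betaMoment (p r : ℝ) (j : ℕ) : ℝ := ∏ i ∈ Finset.range j, ((p + i) / (r + i))

lemma betaMoment_succ (p r : ℝ) (j : ℕ) :
    betaMoment p r (j + 1) = betaMoment p r j * ((p + j) / (r + j)) := Finset.prod_range_succ _ _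

lemma measurable_betaPDF (p q : ℝ) : Measurable (betaPDF p q) :=
  (measurable_betaPDFReal p q).ennreal_ofReal

lemma betaMeasure_ae_mem {p q : ℝ} : ∀ᵐ w ∂(betaMeasure p q), w ∈ Set.Ioo (0 : ℝ) 1 := by
  rw [betaMeasure, ae_withDensity_iff (measurable_betaPDF p q)]
  refine Filter.Eventually.of_forall fun w hw => ?_
  by_contra h
  refine hw ?_
  rw [betaPDF, betaPDFReal, if_neg (by simpa using h), ENNReal.ofReal_zero]

lemma beta_add_nat {p q : ℝ} (hp : 0 < p) (hq : 0 < q) (j : ℕ) :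
    beta (p + j) q = beta p q * betaMoment p (p + q) j := by
  induction j with
  | zero => simp [betaMoment]
  | succ j ih =>
    rw [betaMoment_succ, ← mul_assoc, ← ih, beta, beta]
    push_cast
    have h1 : (0 : ℝ) < p + j := by positivity
    have h2 : 0 < p + q + j := by positivity
    have h3 := Real.Gamma_pos_of_pos h2
    rw [← add_assoc, Real.Gamma_add_one h1.ne', show p + j + 1 + q = (p + q + j) + 1 by ring,
      Real.Gamma_add_one h2.ne', show p + j + q = p + q + j by ring]
    field_simp

lemma integral_pow_betaMeasure {p q : ℝ} (hp : 0 < p) (hq : 0 < q) (j : ℕ) :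
    ∫ w, w ^ j ∂(betaMeasure p q) = betaMoment p (p + q) j := by
  have hb := beta_pos hp hq
  have hpj : (0 : ℝ) < p + j := by positivity
  have hbj := beta_pos hpj hq
  rw [integral_eq_lintegral_of_nonneg_ae
    (by filter_upwards [betaMeasure_ae_mem] with w hw using pow_nonneg hw.1.le j) (by fun_prop),
    betaMeasure, lintegral_withDensity_eq_lintegral_mul _
      (measurable_betaPDF p q) (by fun_prop)]
  -- Multiplying the density by `w ^ j` gives a multiple of the beta density with first parameter `p
  -- + j`, whose total mass is one.
  have e : ∀ w, (betaPDF p q * fun a => ENNReal.ofReal (a ^ j)) w =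
      ENNReal.ofReal (beta (p + j) q / beta p q) * betaPDF (p + j) q w := by
    intro w
    simp only [Pi.mul_apply, betaPDF, betaPDFReal]
    split_ifs with h
    · rw [← ENNReal.ofReal_mul' (pow_nonneg h.1.le j), ← ENNReal.ofReal_mul (by positivity),
        show p + (j : ℝ) - 1 = p - 1 + j by ring, Real.rpow_add_natCast h.1.ne']
      congr 1
      field_simp
    · simp
  simp only [e]
  rw [lintegral_const_mul _ (measurable_betaPDF _ _),
    lintegral_betaPDF_eq_one hpj hq, mul_one, ENNReal.toReal_ofReal (by positivity),
    beta_add_nat hp hq]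
  field_simp

/-! ### Joint measurability in the sample point and the time -/

section Measurability

variable {Ω : Type*} [MeasurableSpace Ω] {S θ : ℕ → Ω → ℝ}

lemma measurable_eventCount (hS : ∀ j, Measurable (S j)) :
    Measurable fun z : Ω × ℝ => eventCount S z.2 z.1 := by
  refine measurable_ncard.comp (measurable_set_iff.mpr fun k => ?_)
  by_cases hk : 1 ≤ k
  · simp only [Set.mem_ofPred_eq, hk, true_and]
    exact (measurableSet_le ((hS k).comp measurable_fst) measurable_snd).mem
  · simp [hk]

lemma measurable_frictionPosition (hS : ∀ j, Measurable (S j)) (hθ : ∀ j, Measurable (θ j))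
    (c : ℝ) : Measurable fun z : Ω × ℝ => frictionPosition c S θ z.2 z.1 := by
  -- The count is made a separate countable variable, so that the range of summation is fixed on
  -- each slice.
  have h : Measurable fun p : ℕ × (Ω × ℝ) => c * ∑ j ∈ Finset.range (p.1 + 1),
      ((if j = p.1 then p.2.2 else S (j + 1) p.2.1) - S j p.2.1) * Real.cos (θ j p.2.1) := by
    refine measurable_from_prod_countable_right fun n => ?_
    simp only
    refine Measurable.const_mul (Finset.measurable_fun_sum _ fun j _ => ?_) c
    by_cases hj : j = n
    · simp only [hj, if_true]
      fun_prop
    · simp only [hj, if_false]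
      fun_prop
  exact h.comp ((measurable_eventCount hS).prodMk measurable_id)

end Measurability

/-! ### The normal law with beta-distributed variance -/

/-- The law of `σ √w x`, where `w` has the beta law with parameters `p`, `q` and `x` is standard
normal. -/
noncomputable def normalBetaMixture (σ p q : ℝ) : Measure ℝ :=
  ((betaMeasure p q).prod (gaussianReal 0 1)).map fun z => σ * Real.sqrt z.1 * z.2

namespace normalBetaMixture

variable {σ p q : ℝ}

/-- Since `√w ≤ 1`, integrability for the mixture follows from the normal law alone. -/
lemma ae_abs_le (hp : 0 < p) (hq : 0 < q) :
    ∀ᵐ z ∂((betaMeasure p q).prod (gaussianReal 0 1)),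
      |σ * Real.sqrt z.1 * z.2| ≤ |σ * z.2| := by
  have := isProbabilityMeasureBeta hp hq
  filter_upwards [Measure.quasiMeasurePreserving_fst.ae (betaMeasure_ae_mem (p := p) (q := q))]
    with z hz
  have h1 : Real.sqrt z.1 ≤ 1 := Real.sqrt_le_one.mpr hz.2.le
  rw [mul_right_comm, abs_mul, abs_of_nonneg (Real.sqrt_nonneg _)]
  exact mul_le_of_le_one_right (abs_nonneg _) h1

lemma integrable_pow (hp : 0 < p) (hq : 0 < q) (k : ℕ) :
    Integrable (fun x => x ^ k) (normalBetaMixture σ p q) := by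
  have := isProbabilityMeasureBeta hp hq
  rw [normalBetaMixture, integrable_map_measure (by fun_prop) (by fun_prop)]
  have h := ((integrable_pow_gaussianReal k).const_mul (σ ^ k)).norm.comp_snd (betaMeasure p q)
  refine h.mono' (by fun_prop) ?_
  filter_upwards [ae_abs_le (σ := σ) hp hq] with z hz
  simp only [Function.comp_apply, norm_pow, ← mul_pow, Real.norm_eq_abs]
  exact pow_le_pow_left₀ (abs_nonneg _) hz k

lemma integrable_cosh (hp : 0 < p) (hq : 0 < q) (u : ℝ) :
    Integrable (fun x => Real.cosh (u * x)) (normalBetaMixture σ p q) := by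
  have := isProbabilityMeasureBeta hp hq
  have hm : ∀ u, Measurable fun x : ℝ => Real.cosh (u * x) :=
    fun u => Real.continuous_cosh.measurable.comp (by fun_prop)
  rw [normalBetaMixture, integrable_map_measure (hm u).aestronglyMeasurable (by fun_prop)]
  have h : Integrable (fun x => Real.cosh (u * σ * x)) (gaussianReal 0 1) := by
    have h1 := (integrable_exp_mul_gaussianReal (μ := 0) (v := 1) (u * σ)).add
      (integrable_exp_mul_gaussianReal (μ := 0) (v := 1) (-(u * σ)))
    refine (h1.div_const 2).congr (Filter.Eventually.of_forall fun x => ?_)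
    simp only [Pi.add_apply]
    rw [Real.cosh_eq, neg_mul]
  refine (h.comp_snd (betaMeasure p q)).mono'
    ((hm u).comp (by fun_prop)).aestronglyMeasurable ?_
  filter_upwards [ae_abs_le (σ := σ) hp hq] with z hz
  simp only [Function.comp_apply]
  rw [Real.norm_eq_abs, abs_of_pos (Real.cosh_pos _), Real.cosh_le_cosh, mul_assoc u σ, abs_mul u, abs_mul u]
  gcongr

lemma integral_pow_even (hp : 0 < p) (hq : 0 < q) (j : ℕ) :
    ∫ x, x ^ (2 * j) ∂(normalBetaMixture σ p q) =
      σ ^ (2 * j) * (betaMoment p (p + q) j * normalMoment (2 * j)) := by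
  have := isProbabilityMeasureBeta hp hq
  rw [normalBetaMixture, integral_map (by fun_prop) (by fun_prop), ← integral_pow_gaussianReal,
    ← integral_pow_betaMeasure hp hq, ← integral_prod_mul, ← integral_const_mul]
  refine integral_congr_ae ?_
  filter_upwards [Measure.quasiMeasurePreserving_fst.ae (betaMeasure_ae_mem (p := p) (q := q))]
    with z hz
  rw [mul_pow, mul_pow, pow_mul (Real.sqrt z.1), Real.sq_sqrt hz.1.le]
  ring

lemma integral_pow_odd (hp : 0 < p) (hq : 0 < q) (j : ℕ) :
    ∫ x, x ^ (2 * j + 1) ∂(normalBetaMixture σ p q) = 0 := by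
  have := isProbabilityMeasureBeta hp hq
  rw [normalBetaMixture, integral_map (by fun_prop) (by fun_prop)]
  simp only [mul_pow _ _ (2 * j + 1)]
  rw [integral_prod_mul (fun w : ℝ => σ ^ (2 * j + 1) * Real.sqrt w ^ (2 * j + 1))
    (fun x : ℝ => x ^ (2 * j + 1)), integral_pow_gaussianReal, normalMoment_odd, mul_zero]

lemma isFiniteMeasure (hp : 0 < p) (hq : 0 < q) : IsFiniteMeasure (normalBetaMixture σ p q) := by
  have := isProbabilityMeasureBeta hp hq
  rw [normalBetaMixture]
  infer_instance

end normalBetaMixture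

/-! ### Conditioning on the count, then averaging over time -/

/-- The probability that a Poisson process of rate `lam` has `n` events up to time `s`. -/
noncomputable def poissonWeight (lam : ℝ) (n : ℕ) (s : ℝ) : ℝ :=
  Real.exp (-(lam * s)) * (lam * s) ^ n / n.factorial

lemma poissonWeight_pos {lam s : ℝ} (hlam : 0 < lam) (hs : 0 < s) (n : ℕ) :
    0 < poissonWeight lam n s := by
  unfold poissonWeight
  positivity

lemma measurable_poissonWeight (lam : ℝ) (n : ℕ) : Measurable (poissonWeight lam n) := by
  unfold poissonWeight
  fun_prop

/-- The density that conditions on `n` events up to time `s`. -/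
noncomputable def countWeight {Ω : Type*} (lam : ℝ) (S : ℕ → Ω → ℝ) (n : ℕ) (z : Ω × ℝ) : ℝ≥0∞ :=
  if eventCount S z.2 z.1 = n then ENNReal.ofReal (1 / poissonWeight lam n z.2) else 0

lemma measurable_countWeight {Ω : Type*} [MeasurableSpace Ω] {S : ℕ → Ω → ℝ}
    (hS : ∀ j, Measurable (S j)) (lam : ℝ) (n : ℕ) : Measurable (countWeight lam S n) :=
  Measurable.ite (measurable_eventCount hS (measurableSet_singleton n))
    (((measurable_poissonWeight lam n).comp measurable_snd).const_div 1).ennreal_ofReal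
    measurable_const

/-- The position at an independent time with law `ρ`, conditioned on `n` events for each value of
the time. -/
noncomputable def countConditionedLaw {Ω : Type*} [MeasurableSpace Ω] (P : Measure Ω) (lam c : ℝ)
    (S θ : ℕ → Ω → ℝ) (n : ℕ) (ρ : Measure ℝ) : Measure ℝ :=
  ((P.prod ρ).withDensity (countWeight lam S n)).map fun z => frictionPosition c S θ z.2 z.1

namespace countConditionedLaw

variable {Ω : Type*} [MeasurableSpace Ω] {P : Measure Ω} [IsProbabilityMeasure P] {lam c : ℝ}
  {S θ : ℕ → Ω → ℝ} {n : ℕ} {ρ : Measure ℝ} [IsProbabilityMeasure ρ]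

lemma apply (hS : ∀ j, Measurable (S j)) (hθ : ∀ j, Measurable (θ j)) {A : Set ℝ}
    (hA : MeasurableSet A) : countConditionedLaw P lam c S θ n ρ A =
      ∫⁻ s, ENNReal.ofReal (1 / poissonWeight lam n s) *
        P {ω | eventCount S s ω = n ∧ frictionPosition c S θ s ω ∈ A} ∂ρ := by
  have hF := measurable_frictionPosition hS hθ c
  have hW := measurable_countWeight hS lam n
  have hN := measurable_eventCount hS
  rw [countConditionedLaw, Measure.map_apply hF hA, withDensity_apply _ (hF hA),
    ← lintegral_indicator (hF hA), lintegral_prod_symm' _ (hW.indicator (hF hA))]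
  refine lintegral_congr fun s => ?_
  have hset : MeasurableSet {ω | eventCount S s ω = n ∧ frictionPosition c S θ s ω ∈ A} :=
    ((hN.comp (measurable_id.prodMk measurable_const)) (measurableSet_singleton n)).inter
      ((hF.comp (measurable_id.prodMk measurable_const)) hA)
  rw [← lintegral_indicator_one hset, ← lintegral_const_mul _ (measurable_one.indicator hset)]
  refine lintegral_congr fun ω => ?_
  classical
  simp only [Set.indicator_apply, Set.mem_preimage, countWeight, Set.mem_ofPred_eq, Pi.one_apply]
  by_cases h1 : eventCount S s ω = n <;> by_cases h2 : frictionPosition c S θ s ω ∈ A <;>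
    simp [h1, h2]

variable {m : Fin 2}

/-- The density cancels the Poisson probability in `integral_eventPosition_pow` for each time, and
Fubini integrates the result over `ρ`. -/
lemma moments (hX : IsFrictionMotion P lam ((m : ℕ) : ℝ) S θ) (hlam : 0 < lam) (hc : 0 ≤ c)
    (hn : 1 ≤ n) (hρ : ∀ᵐ s ∂ρ, 0 < s) (hint : ∀ k : ℕ, Integrable (fun s => s ^ k) ρ) (k : ℕ) :
    Integrable (fun x => x ^ k) (countConditionedLaw P lam c S θ n ρ) ∧
    ∫ x, x ^ k ∂(countConditionedLaw P lam c S θ n ρ) =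
      c ^ k * frictionMoment (motionIndex m n) k * ∫ s, s ^ k ∂ρ := by
  have hS := hX.measurable_time
  have hθ := hX.measurable_angle
  have hF := measurable_frictionPosition hS hθ c
  have hW := measurable_countWeight hS lam n
  have hN := measurable_eventCount hS
  have hWtop : ∀ z, countWeight lam S n z < ⊤ := by
    intro z
    rw [countWeight]
    split_ifs
    · exact ENNReal.ofReal_lt_top
    · exact ENNReal.zero_lt_top
  set G : Ω × ℝ → ℝ := fun z =>
    (countWeight lam S n z).toReal * frictionPosition c S θ z.2 z.1 ^ k with hG
  have hGm : Measurable G := hW.ennreal_toReal.mul (hF.pow_const k)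
  have hsec : ∀ s, 0 < s → ∀ ω, G (ω, s) = (1 / poissonWeight lam n s) *
      (if eventCount S s ω = n then frictionPosition c S θ s ω ^ k else 0) := by
    intro s hs ω
    have := poissonWeight_pos hlam hs n
    simp only [hG, countWeight]
    split_ifs
    · rw [ENNReal.toReal_ofReal (by positivity)]
    · simp
  -- Speed at most `c` bounds the position by `c s`. The power `0` is kept so that the zeroth moment
  -- gives the integral of the bound as exactly `(c s) ^ k`.
  have hbound : ∀ s, 0 < s → ∀ᵐ ω ∂P, ‖G (ω, s)‖ ≤ (c * s) ^ k * ((1 / poissonWeight lam n s) *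
      (if eventCount S s ω = n then frictionPosition c S θ s ω ^ 0 else 0)) := by
    intro s hs
    have := poissonWeight_pos hlam hs n
    filter_upwards [hX.ae_gap_pos] with ω hω
    rw [hsec s hs]
    split_ifs with h
    · have h2 := abs_frictionPosition_le (θ := θ) (hX.start_zero ω) hω hc s hn h
      rw [abs_of_pos hs] at h2
      rw [norm_mul, norm_pow, pow_zero, mul_one, Real.norm_eq_abs,
        abs_of_pos (by positivity : 0 < 1 / poissonWeight lam n s), mul_comm]
      exact mul_le_mul_of_nonneg_right (pow_le_pow_left₀ (abs_nonneg _) h2 k) (by positivity)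
    · simp
  have hindI : ∀ s, Integrable (fun ω => if eventCount S s ω = n then
      frictionPosition c S θ s ω ^ 0 else 0) P := by
    intro s
    refine Integrable.of_bound ?_ 1 (Filter.Eventually.of_forall fun ω => ?_)
    · simp only [pow_zero]
      exact (Measurable.ite ((hN.comp (measurable_id.prodMk measurable_const))
        (measurableSet_singleton n)) measurable_const measurable_const).aestronglyMeasurable
    · split_ifs <;> simp
  have hsecI : ∀ s, 0 < s → Integrable (fun ω => G (ω, s)) P := by
    intro s hs
    exact (((hindI s).const_mul _).const_mul _).mono'
      (hGm.comp (measurable_id.prodMk measurable_const)).aestronglyMeasurable (hbound s hs)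
  have hGI : Integrable G (P.prod ρ) := by
    rw [integrable_prod_iff' hGm.aestronglyMeasurable]
    refine ⟨hρ.mono hsecI, ?_⟩
    refine ((hint k).const_mul (c ^ k)).mono'
      (hGm.stronglyMeasurable.norm.integral_prod_left').aestronglyMeasurable ?_
    filter_upwards [hρ] with s hs
    rw [Real.norm_eq_abs, abs_of_nonneg (integral_nonneg fun ω => norm_nonneg _)]
    refine (integral_mono_ae (hsecI s hs).norm (((hindI s).const_mul _).const_mul _)
      (hbound s hs)).trans (le_of_eq ?_)
    rw [integral_const_mul, integral_const_mul, integral_eventPosition_pow hX hlam c hs.le hn 0]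
    have := (poissonWeight_pos hlam hs n).ne'
    change (c * s) ^ k * (1 / poissonWeight lam n s * (poissonWeight lam n s * _ * _)) = _
    rw [frictionMoment]
    field_simp
    ring
  have hae : ∀ᵐ z ∂(P.prod ρ), countWeight lam S n z < ⊤ := Filter.Eventually.of_forall hWtop
  constructor
  · rw [countConditionedLaw, integrable_map_measure (by fun_prop) hF.aemeasurable,
      integrable_withDensity_iff_integrable_smul' hW hae]
    exact hGI
  · rw [countConditionedLaw, integral_map hF.aemeasurable (by fun_prop),
      integral_withDensity_eq_integral_toReal_smul hW hae]
    change ∫ z, G z ∂(P.prod ρ) = _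
    rw [integral_prod_symm _ hGI, ← integral_const_mul]
    refine integral_congr_ae ?_
    filter_upwards [hρ] with s hs
    simp only [hsec s hs]
    rw [integral_const_mul, integral_eventPosition_pow hX hlam c hs.le hn k]
    have := (poissonWeight_pos hlam hs n).ne'
    change 1 / poissonWeight lam n s * (poissonWeight lam n s * _ * _) = _
    field_simp
    ring

end countConditionedLaw

/-! ### The Bessel variable at a fixed time, and matching of moments -/

/-- At each step, `(2j + 1) / (2 (v + 1 + j))` times `d + 2j` equals the normal factor `2j + 1`
times the beta factor `(d / 2 + j) / (v + 1 + j)`. -/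
lemma frictionMoment_mul_chiSqMoment {v : ℝ} (hv : 0 ≤ v) (d : ℝ) (j : ℕ) :
    frictionMoment v (2 * j) * chiSqMoment d j =
      betaMoment (d / 2) (v + 1) j * normalMoment (2 * j) := by
  induction j with
  | zero => simp [frictionMoment, chiSqMoment, betaMoment, normalMoment]
  | succ j ih =>
    rw [show 2 * (j + 1) = 2 * j + 2 by ring, frictionMoment_two_add, chiSqMoment_succ,
      betaMoment_succ, normalMoment]
    have h1 : (0 : ℝ) < v + 1 + j := by positivity
    have h2 : (0 : ℝ) < ((2 * j : ℕ) : ℝ) + 2 + 2 * v := by positivity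
    have e : ((2 * j : ℕ) : ℝ) + 2 + 2 * v = 2 * (v + 1 + j) := by push_cast; ring
    rw [e]
    rw [show (((2 * j : ℕ) : ℝ) + 1) / (2 * (v + 1 + j)) * frictionMoment v (2 * j) *
      (chiSqMoment d j * (d + 2 * j)) = (((2 * j : ℕ) : ℝ) + 1) / (2 * (v + 1 + j)) * (d + 2 * j) *
      (frictionMoment v (2 * j) * chiSqMoment d j) by ring, ih]
    field_simp

lemma motionIndex_nonneg (m : Fin 2) (n : ℕ) : 0 ≤ motionIndex m n := by
  unfold motionIndex
  split_ifs <;> positivity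

section Bessel

variable {Ω : Type*} [MeasurableSpace Ω] {P : Measure Ω} {d : ℕ}
  {B : Fin d → ℝ≥0 → Ω → ℝ}

lemma measurable_besselProcess (hB : ∀ i s, Measurable (B i s)) (g : ℝ≥0) :
    Measurable (besselProcess B g) := by
  unfold besselProcess
  fun_prop

lemma besselProcess_ae_pos (hB : IsIndepBrownian P B) (hd : 1 ≤ d) {g : ℝ≥0} (hg : g ≠ 0) :
    ∀ᵐ s ∂(P.map (besselProcess B g)), 0 < s := by
  rw [ae_map_iff (measurable_besselProcess hB.measurable g).aemeasurable measurableSet_Ioi]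
  have hlaw := (hB.brownian ⟨0, hd⟩).hasLaw_eval g
  have h : ∀ᵐ x ∂(gaussianReal 0 g), x ≠ 0 := by
    have := nullSingletonClass_gaussianReal (μ := 0) hg
    exact Measure.ae_ne _ 0
  rw [← hlaw.map_eq] at h
  filter_upwards [ae_of_ae_map hlaw.aemeasurable h] with ω hω
  refine Real.sqrt_pos.mpr (lt_of_lt_of_le (by positivity : 0 < B ⟨0, hd⟩ g ω ^ 2) ?_)
  exact Finset.single_le_sum (f := fun i => B i g ω ^ 2) (fun i _ => sq_nonneg _)
    (Finset.mem_univ _)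

lemma moments_of_hasLaw_gaussianReal {X : Ω → ℝ} {g : ℝ≥0} (h : HasLaw X (gaussianReal 0 g) P)
    (k : ℕ) : Integrable (fun ω => X ω ^ (2 * k)) P ∧
      ∫ ω, X ω ^ (2 * k) ∂P = (g : ℝ) ^ k * chiSqMoment 1 k := by
  have e : gaussianReal 0 g = (gaussianReal 0 1).map fun x => Real.sqrt g * x := by
    rw [gaussianReal_map_const_mul, mul_zero, mul_one]
    congr 1
    ext
    simp
  have hmap := h.map_eq
  rw [e] at hmap
  have h1 : Integrable (fun x => x ^ (2 * k)) (P.map X) := by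
    rw [hmap, integrable_map_measure (by fun_prop) (by fun_prop)]
    simp only [Function.comp_def, mul_pow]
    exact (integrable_pow_gaussianReal _).const_mul _
  refine ⟨(integrable_map_measure (g := fun x : ℝ => x ^ (2 * k)) (by fun_prop) h.aemeasurable).mp h1, ?_⟩
  have h2 : ∫ x, x ^ (2 * k) ∂(P.map X) = (g : ℝ) ^ k * chiSqMoment 1 k := by
    rw [hmap, integral_map (by fun_prop) (by fun_prop)]
    simp only [mul_pow]
    rw [integral_const_mul, integral_pow_gaussianReal, chiSqMoment_one, pow_mul (Real.sqrt g),
      Real.sq_sqrt g.coe_nonneg]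
  rw [← h2, integral_map (f := fun x : ℝ => x ^ (2 * k)) h.aemeasurable (by fun_prop)]

variable [IsProbabilityMeasure P]

lemma besselProcess_moments (hB : IsIndepBrownian P B) (g : ℝ≥0) (k : ℕ) :
    Integrable (fun s => s ^ (2 * k)) (P.map (besselProcess B g)) ∧
      ∫ s, s ^ (2 * k) ∂(P.map (besselProcess B g)) = (g : ℝ) ^ k * chiSqMoment d k := by
  have hm := measurable_besselProcess hB.measurable g
  have hind : iIndepFun (fun i => B i g) P :=
    hB.indep.comp (fun _ x => x g) (fun _ => measurable_pi_apply g)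
  have h := integral_sum_sq_pow (fun i => hB.measurable i g) hind (v := g)
    (fun i k => (moments_of_hasLaw_gaussianReal ((hB.brownian i).hasLaw_eval g) k).1)
    (fun i k => (moments_of_hasLaw_gaussianReal ((hB.brownian i).hasLaw_eval g) k).2) Finset.univ k
  have e : ∀ ω, besselProcess B g ω ^ (2 * k) = (∑ i, B i g ω ^ 2) ^ k := by
    intro ω
    rw [besselProcess, pow_mul, Real.sq_sqrt (Finset.sum_nonneg fun i _ => sq_nonneg _)]
  rw [integrable_map_measure (by fun_prop) hm.aemeasurable,
    integral_map hm.aemeasurable (by fun_prop)]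
  simp only [Function.comp_def, e]
  simpa using h

/-- Only even moments of the Bessel variable have to be known: for odd degree the angular factor
vanishes. The condition on `d` makes the second beta parameter positive. -/
theorem countConditionedLaw_besselProcess {m : Fin 2} {lam c : ℝ} {S θ : ℕ → Ω → ℝ} {n : ℕ}
    (hX : IsFrictionMotion P lam ((m : ℕ) : ℝ) S θ) (hlam : 0 < lam) (hc : 0 ≤ c) (hn : 1 ≤ n)
    (hB : IsIndepBrownian P B) (hd : 1 ≤ d) (hv : (d : ℝ) / 2 - 1 < motionIndex m n)
    {g : ℝ≥0} (hg : g ≠ 0) :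
    countConditionedLaw P lam c S θ n (P.map (besselProcess B g)) =
      normalBetaMixture (c * Real.sqrt g) ((d : ℝ) / 2) (motionIndex m n - (d : ℝ) / 2 + 1) := by
  have hp : 0 < (d : ℝ) / 2 := by positivity
  have hq : 0 < motionIndex m n - (d : ℝ) / 2 + 1 := by linarith
  have hpq : (d : ℝ) / 2 + (motionIndex m n - (d : ℝ) / 2 + 1) = motionIndex m n + 1 := by ring
  have := Measure.isProbabilityMeasure_map (μ := P) (measurable_besselProcess hB.measurable g).aemeasurable
  have hpos := besselProcess_ae_pos hB hd hg
  have hint : ∀ k : ℕ, Integrable (fun s => s ^ k) (P.map (besselProcess B g)) := by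
    intro k
    refine ((integrable_const (1 : ℝ)).add (besselProcess_moments hB g k).1).mono'
      (by fun_prop) ?_
    filter_upwards [hpos] with s hs
    rw [Real.norm_eq_abs, abs_of_pos (by positivity)]
    simp only [Pi.add_apply]
    rw [mul_comm, pow_mul]
    -- Odd powers are dominated through `s ^ k ≤ 1 + s ^ (2 k)`.
    nlinarith [sq_nonneg (s ^ k - 1)]
  have hmom := countConditionedLaw.moments hX hlam hc hn hpos hint
  have hfin : IsFiniteMeasure
      (countConditionedLaw P lam c S θ n (P.map (besselProcess B g))) := by
    have h0 := (hmom 0).1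
    simp only [pow_zero] at h0
    exact (integrable_const_iff_isFiniteMeasure one_ne_zero).mp h0
  have := normalBetaMixture.isFiniteMeasure (σ := c * Real.sqrt g) hp hq
  refine Measure.ext_of_moments_of_integrable_cosh (fun k => (hmom k).1)
    (normalBetaMixture.integrable_pow hp hq) (fun k => ?_)
    (normalBetaMixture.integrable_cosh hp hq)
  rw [(hmom k).2]
  rcases Nat.even_or_odd' k with ⟨j, rfl | rfl⟩
  · rw [normalBetaMixture.integral_pow_even hp hq, (besselProcess_moments hB g j).2, hpq,
      ← frictionMoment_mul_chiSqMoment (motionIndex_nonneg m n), mul_pow c,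
      pow_mul (Real.sqrt g), Real.sq_sqrt g.coe_nonneg]
    ring
  · rw [normalBetaMixture.integral_pow_odd hp hq, frictionMoment_odd]
    ring

end Bessel

/-! ### Normal densities averaged over a gamma variance -/

/-- The density of the centred normal law with standard deviation `τ`. -/
noncomputable def normalDensity (τ x : ℝ) : ℝ :=
  (Real.sqrt (2 * Real.pi) * τ)⁻¹ * Real.exp (-(x ^ 2 / (2 * τ ^ 2)))

@[fun_prop]
lemma measurable_normalDensity : Measurable fun z : ℝ × ℝ => normalDensity z.1 z.2 := by
  unfold normalDensity
  fun_prop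

lemma gaussianReal_map_const_mul_eq {τ : ℝ} (hτ : 0 < τ) :
    (gaussianReal 0 1).map (fun x => τ * x) =
      volume.withDensity fun x => ENNReal.ofReal (normalDensity τ x) := by
  have hne : (NNReal.mk (τ ^ 2) (sq_nonneg τ)) * 1 ≠ 0 := by
    rw [mul_one]
    intro h
    have := congrArg NNReal.toReal h
    simp at this
    exact hτ.ne' this
  rw [gaussianReal_map_const_mul, gaussianReal_of_var_ne_zero _ hne]
  congr 1
  ext x
  rw [gaussianPDF, gaussianPDFReal_def, normalDensity]
  simp only [mul_zero, sub_zero, mul_one, NNReal.coe_mk]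
  rw [Real.sqrt_mul (by positivity), Real.sqrt_sq hτ.le, neg_div]

/-- A bound uniform in `τ`, the source of all finiteness below. It uses `exp (-y) ≤ 1 / (1 + y)` and
then completes squares to get `τ (1 + x ^ 2 / (2 τ ^ 2)) ≥ |x|`. -/
lemma normalDensity_le {τ x : ℝ} (hτ : 0 ≤ τ) (hx : x ≠ 0) : normalDensity τ x ≤ 1 / |x| := by
  have hx' : 0 < |x| := abs_pos.mpr hx
  -- For `τ = 0` the inverse, hence the density, is `0` by convention.
  rcases hτ.eq_or_lt with rfl | hτ
  · simp [normalDensity]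
  have hpi : 1 ≤ Real.sqrt (2 * Real.pi) := by
    rw [Real.one_le_sqrt]
    linarith [Real.pi_gt_three]
  have h1 : Real.exp (-(x ^ 2 / (2 * τ ^ 2))) ≤ (1 + x ^ 2 / (2 * τ ^ 2))⁻¹ := by
    rw [Real.exp_neg]
    exact inv_anti₀ (by positivity) (by linarith [Real.add_one_le_exp (x ^ 2 / (2 * τ ^ 2))])
  have h2 : (Real.sqrt (2 * Real.pi) * τ)⁻¹ ≤ τ⁻¹ :=
    inv_anti₀ hτ (le_mul_of_one_le_left hτ.le hpi)
  refine (mul_le_mul h2 h1 (by positivity) (by positivity)).trans ?_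
  rw [← mul_inv, inv_eq_one_div]
  refine one_div_le_one_div_of_le hx' ?_
  rw [← sq_abs x]
  have e : τ * (1 + |x| ^ 2 / (2 * τ ^ 2)) = |x| + ((τ - |x|) ^ 2 + τ ^ 2) / (2 * τ) := by
    field_simp
    ring
  rw [e]
  have : 0 ≤ ((τ - |x|) ^ 2 + τ ^ 2) / (2 * τ) := by positivity
  linarith

lemma normalBetaMixture_apply {σ p q : ℝ} (hσ : 0 < σ) (hp : 0 < p) (hq : 0 < q) {A : Set ℝ}
    (hA : MeasurableSet A) : normalBetaMixture σ p q A =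
      ∫⁻ w, ∫⁻ x in A, ENNReal.ofReal (normalDensity (σ * Real.sqrt w) x)
        ∂volume ∂(betaMeasure p q) := by
  have := isProbabilityMeasureBeta hp hq
  have hm : Measurable fun z : ℝ × ℝ => σ * Real.sqrt z.1 * z.2 := by fun_prop
  rw [normalBetaMixture, Measure.map_apply hm hA, Measure.prod_apply (hm hA)]
  refine lintegral_congr_ae ?_
  filter_upwards [betaMeasure_ae_mem (p := p) (q := q)] with w hw
  have hw' : 0 < σ * Real.sqrt w := mul_pos hσ (Real.sqrt_pos.mpr hw.1)
  rw [← withDensity_apply _ hA, ← gaussianReal_map_const_mul_eq hw',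
    Measure.map_apply (by fun_prop) hA]
  rfl

lemma gammaMeasure_ae_pos (a t : ℝ) : ∀ᵐ g ∂(gammaMeasure a t), 0 < g := by
  have h1 : ∀ᵐ x ∂(gammaMeasure a t), x ≠ 0 :=
    (withDensity_absolutelyContinuous _ _).ae_le (Measure.ae_ne volume 0)
  have h2 : gammaMeasure a t (Set.Iio 0) = 0 := by
    rw [gammaMeasure, withDensity_apply _ measurableSet_Iio]
    exact lintegral_gammaPDF_of_nonpos le_rfl
  have h3 : ∀ᵐ x ∂(gammaMeasure a t), 0 ≤ x := by simpa [ae_iff, Set.Iio] using h2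
  filter_upwards [h1, h3] with x h1 h3 using lt_of_le_of_ne h3 h1.symm

lemma lintegral_normalBetaMixture {a t c p q : ℝ} (ha : 0 < a) (ht : 0 < t) (hc : 0 < c)
    (hp : 0 < p) (hq : 0 < q) {A : Set ℝ} (hA : MeasurableSet A) :
    ∫⁻ g, normalBetaMixture (c * Real.sqrt g) p q A ∂(gammaMeasure a t) =
      ∫⁻ x in A, ∫⁻ w, ∫⁻ g, ENNReal.ofReal (normalDensity (c * Real.sqrt g * Real.sqrt w) x)
        ∂(gammaMeasure a t) ∂(betaMeasure p q) := by
  have := isProbabilityMeasureBeta hp hq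
  have := isProbabilityMeasure_gammaMeasure ha ht
  have h1 : ∫⁻ g, normalBetaMixture (c * Real.sqrt g) p q A ∂(gammaMeasure a t) =
      ∫⁻ g, ∫⁻ x in A, ∫⁻ w, ENNReal.ofReal (normalDensity (c * Real.sqrt g * Real.sqrt w) x)
        ∂(betaMeasure p q) ∂volume ∂(gammaMeasure a t) := by
    refine lintegral_congr_ae ?_
    filter_upwards [gammaMeasure_ae_pos a t] with g hg
    rw [normalBetaMixture_apply (mul_pos hc (Real.sqrt_pos.mpr hg)) hp hq hA]
    refine lintegral_lintegral_swap ?_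
    have : Measurable fun z : ℝ × ℝ =>
      ENNReal.ofReal (normalDensity (c * Real.sqrt g * Real.sqrt z.1) z.2) := by fun_prop
    exact this.aemeasurable
  rw [h1, lintegral_lintegral_swap]
  · refine lintegral_congr fun x => ?_
    refine lintegral_lintegral_swap ?_
    have : Measurable fun z : ℝ × ℝ =>
      ENNReal.ofReal (normalDensity (c * Real.sqrt z.1 * Real.sqrt z.2) x) := by fun_prop
    exact this.aemeasurable
  · have h2 : Measurable fun z : (ℝ × ℝ) × ℝ =>
      ENNReal.ofReal (normalDensity (c * Real.sqrt z.1.1 * Real.sqrt z.2) z.1.2) := by fun_prop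
    exact (h2.lintegral_prod_right' (ν := betaMeasure p q)).aemeasurable

/-- The substitution `g = z e ^ u` symmetrises the exponent, as `t g + t z ^ 2 / g = 2 t z cosh u`.
Folding the line at `0` then turns `e ^ (r u)` into `2 cosh (r u)`. -/
lemma lintegral_rpow_mul_exp_eq_besselK {t z : ℝ} (hz : 0 < z) (r : ℝ) :
    ∫⁻ g in Set.Ioi (0 : ℝ), ENNReal.ofReal (g ^ (r - 1) * Real.exp (-(t * g + t * z ^ 2 / g))) =
      ENNReal.ofReal (2 * z ^ r) * ∫⁻ u in Set.Ioi (0 : ℝ),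
        ENNReal.ofReal (Real.exp (-(2 * t * z * Real.cosh u)) * Real.cosh (r * u)) := by
  have himage : (fun u : ℝ => z * Real.exp u) '' Set.univ = Set.Ioi 0 := by
    ext y
    simp only [Set.image_univ, Set.mem_range, Set.mem_Ioi]
    constructor
    · rintro ⟨u, rfl⟩
      positivity
    · intro hy
      refine ⟨Real.log (y / z), ?_⟩
      rw [Real.exp_log (by positivity)]
      field_simp
  have hinj : Set.InjOn (fun u : ℝ => z * Real.exp u) Set.univ := by
    intro u _ v _ h
    exact Real.exp_injective (mul_left_cancel₀ hz.ne' h)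
  have hF : ∀ r : ℝ, Measurable fun u : ℝ => ENNReal.ofReal
      (Real.exp (r * u) * Real.exp (-(2 * t * z * Real.cosh u))) := by
    intro r
    have := Real.continuous_cosh.measurable
    fun_prop
  have hcov := lintegral_image_eq_lintegral_abs_deriv_mul MeasurableSet.univ
    (fun u _ => ((Real.hasDerivAt_exp u).const_mul z).hasDerivWithinAt) hinj
    (fun g => ENNReal.ofReal (g ^ (r - 1) * Real.exp (-(t * g + t * z ^ 2 / g))))
  rw [himage] at hcov
  rw [hcov]
  have e : ∀ u : ℝ, ENNReal.ofReal |z * Real.exp u| * ENNReal.ofReal ((z * Real.exp u) ^ (r - 1) *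
      Real.exp (-(t * (z * Real.exp u) + t * z ^ 2 / (z * Real.exp u)))) =
      ENNReal.ofReal (z ^ r) * ENNReal.ofReal
        (Real.exp (r * u) * Real.exp (-(2 * t * z * Real.cosh u))) := by
    intro u
    have hpos : 0 < z * Real.exp u := by positivity
    rw [abs_of_pos hpos, ← ENNReal.ofReal_mul hpos.le, ← ENNReal.ofReal_mul (by positivity)]
    congr 1
    rw [← mul_assoc, ← mul_assoc, Real.rpow_sub_one hpos.ne', mul_div_cancel₀ _ hpos.ne',
      Real.mul_rpow hz.le (Real.exp_pos u).le, ← Real.exp_mul, mul_comm u r, mul_assoc]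
    congr 3
    rw [Real.cosh_eq, Real.exp_neg]
    field_simp
  simp only [e]
  rw [lintegral_const_mul _ (hF r), setLIntegral_univ,
    ← lintegral_add_compl _ (measurableSet_Ioi (a := (0 : ℝ))), Set.compl_Ioi,
    setLIntegral_congr Iio_ae_eq_Iic.symm]
  have hneg : ∫⁻ u in Set.Iio (0 : ℝ), ENNReal.ofReal
      (Real.exp (r * u) * Real.exp (-(2 * t * z * Real.cosh u))) =
      ∫⁻ u in Set.Ioi (0 : ℝ), ENNReal.ofReal
      (Real.exp (-r * u) * Real.exp (-(2 * t * z * Real.cosh u))) := by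
    have h := (Measure.measurePreserving_neg (volume : Measure ℝ)).setLIntegral_comp_preimage
      (measurableSet_Iio (a := (0 : ℝ))) (hF r)
    rw [← h]
    simp only [Set.neg_preimage, Set.neg_Iio, neg_zero, Real.cosh_neg, mul_neg, neg_mul]
  have h2 : ENNReal.ofReal (2 * z ^ r) = ENNReal.ofReal (z ^ r) * ENNReal.ofReal 2 := by
    rw [mul_comm, ENNReal.ofReal_mul (by positivity)]
  rw [hneg, ← lintegral_add_left (hF r), h2, mul_assoc (ENNReal.ofReal (z ^ r)),
    ← lintegral_const_mul (ENNReal.ofReal 2)]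
  · congr 1
    refine lintegral_congr fun u => ?_
    rw [← ENNReal.ofReal_add (by positivity) (by positivity), ← ENNReal.ofReal_mul (by norm_num)]
    congr 1
    rw [Real.cosh_eq (r * u), neg_mul]
    ring
  · have := Real.continuous_cosh.measurable
    fun_prop

lemma measurable_modifiedBesselK (r : ℝ) : Measurable (modifiedBesselK r) := by
  have h : Continuous fun z : ℝ × ℝ => Real.exp (-(z.1 * Real.cosh z.2)) * Real.cosh (r * z.2) := by
    have := Real.continuous_cosh
    fun_prop
  exact (h.stronglyMeasurable.integral_prod_right'
    (ν := volume.restrict (Set.Ioi (0 : ℝ)))).measurable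

lemma modifiedBesselK_nonneg (r y : ℝ) : 0 ≤ modifiedBesselK r y :=
  integral_nonneg fun _ => mul_nonneg (Real.exp_pos _).le (Real.cosh_pos _).le

lemma modifiedBesselK_neg (r y : ℝ) : modifiedBesselK (-r) y = modifiedBesselK r y := by
  simp only [modifiedBesselK, neg_mul, Real.cosh_neg]

/-- The normal factor contributes `g ^ (-1/2)` and an exponent in `1 / g`; with the gamma density
this is the integral of the substitution lemma with `r = a - 1/2`. Evenness of `K` in its order
gives the index `1/2 - a`. -/
lemma lintegral_gammaMeasure_normalDensity {a t s x : ℝ} (ha : 0 < a) (ht : 0 < t) (hs : 0 < s)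
    (hx : x ≠ 0) :
    ∫⁻ g, ENNReal.ofReal (normalDensity (s * Real.sqrt g) x) ∂(gammaMeasure a t) =
      ENNReal.ofReal (1 / Real.Gamma a * (Real.sqrt (2 * t) / (Real.sqrt Real.pi * s)) *
        (Real.sqrt t * |x| / (Real.sqrt 2 * s)) ^ (a - 1 / 2) *
        modifiedBesselK (1 / 2 - a) (Real.sqrt (2 * t) * |x| / s)) := by
  have := isProbabilityMeasure_gammaMeasure ha ht
  have hx' : 0 < |x| := abs_pos.mpr hx
  have hG := Real.Gamma_pos_of_pos ha
  have hst : 0 < Real.sqrt t := Real.sqrt_pos.mpr ht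
  have hst2 : Real.sqrt t ^ 2 = t := Real.sq_sqrt ht.le
  have hs2 : 0 < Real.sqrt 2 := by positivity
  have hs22 : Real.sqrt 2 ^ 2 = 2 := Real.sq_sqrt (by norm_num)
  have hspi : 0 < Real.sqrt Real.pi := Real.sqrt_pos.mpr Real.pi_pos
  -- Chosen so that `t z ^ 2 = x ^ 2 / (2 s ^ 2)`.
  set z := |x| / (Real.sqrt 2 * s * Real.sqrt t) with hz
  have hz0 : 0 < z := by positivity
  set C := t ^ a / Real.Gamma a / (Real.sqrt (2 * Real.pi) * s) with hC
  have hC0 : 0 < C := by positivity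
  set I := ∫⁻ u in Set.Ioi (0 : ℝ), ENNReal.ofReal
    (Real.exp (-(2 * t * z * Real.cosh u)) * Real.cosh ((a - 1 / 2) * u)) with hI
  have hbound : ∫⁻ g, ENNReal.ofReal (normalDensity (s * Real.sqrt g) x) ∂(gammaMeasure a t) < ⊤ := by
    refine lt_of_le_of_lt (lintegral_mono fun g => ENNReal.ofReal_le_ofReal
      (normalDensity_le (by positivity) hx)) ?_
    rw [lintegral_const, measure_univ, mul_one]
    exact ENNReal.ofReal_lt_top
  have heq : ∫⁻ g, ENNReal.ofReal (normalDensity (s * Real.sqrt g) x) ∂(gammaMeasure a t) =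
      ENNReal.ofReal (C * (2 * z ^ (a - 1 / 2))) * I := by
    have hgm : Measurable (gammaPDF a t) := (measurable_gammaPDFReal a t).ennreal_ofReal
    rw [gammaMeasure, lintegral_withDensity_eq_lintegral_mul _ hgm (by fun_prop),
      ENNReal.ofReal_mul hC0.le, mul_assoc, ← lintegral_rpow_mul_exp_eq_besselK hz0,
      ← lintegral_const_mul' _ _ ENNReal.ofReal_ne_top, ← lintegral_indicator measurableSet_Ioi]
    refine lintegral_congr_ae ?_
    filter_upwards [Measure.ae_ne volume (0 : ℝ)] with g hg0
    simp only [Pi.mul_apply, Set.indicator_apply, Set.mem_Ioi]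
    split_ifs with hg
    · rw [gammaPDF_of_nonneg hg.le, ← ENNReal.ofReal_mul (by positivity),
        ← ENNReal.ofReal_mul hC0.le]
      congr 1
      have hsg : Real.sqrt g * Real.sqrt g = g := Real.mul_self_sqrt hg.le
      have hsg0 : 0 < Real.sqrt g := Real.sqrt_pos.mpr hg
      have e1 : g ^ (a - 1 / 2 - 1) = g ^ (a - 1) / Real.sqrt g := by
        rw [Real.sqrt_eq_rpow, ← Real.rpow_sub hg]
        congr 1
        ring
      have e2 : x ^ 2 / (2 * (s * Real.sqrt g) ^ 2) = t * z ^ 2 / g := by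
        rw [hz, mul_pow, Real.sq_sqrt hg.le, div_pow, mul_pow, mul_pow, hs22, hst2, sq_abs]
        field_simp
      rw [normalDensity, e1, e2, neg_add, Real.exp_add, hC]
      field_simp
    · have : g < 0 := lt_of_le_of_ne (not_lt.mp hg) hg0
      rw [gammaPDF_of_neg this, zero_mul]
  -- Convergence of the integral defining `K` is read off from the uniform bound on the mixture,
  -- without estimating `cosh`; it is needed because `modifiedBesselK` is a Bochner integral.
  have hIfin : I ≠ ⊤ := by
    intro h
    rw [heq, h, ENNReal.mul_top] at hbound
    · exact lt_irrefl _ hbound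
    · rw [ENNReal.ofReal_ne_zero_iff]
      positivity
  have hK : I = ENNReal.ofReal (modifiedBesselK (1 / 2 - a) (2 * t * z)) := by
    rw [← modifiedBesselK_neg, neg_sub, modifiedBesselK, ofReal_integral_eq_lintegral_ofReal]
    · rw [← lintegral_ofReal_ne_top_iff_integrable]
      · exact hIfin
      · have := Real.continuous_cosh
        exact Continuous.aestronglyMeasurable (by fun_prop)
      · exact Filter.Eventually.of_forall fun u =>
          mul_nonneg (Real.exp_pos _).le (Real.cosh_pos _).le
    · exact Filter.Eventually.of_forall fun u =>
        mul_nonneg (Real.exp_pos _).le (Real.cosh_pos _).le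
  rw [heq, hK, ← ENNReal.ofReal_mul (by positivity)]
  have hy : 2 * t * z = Real.sqrt (2 * t) * |x| / s := by
    rw [hz, Real.sqrt_mul (by norm_num), ← hst2]
    field_simp
    rw [Real.sqrt_sq hst.le, hs22]
  have hzt : Real.sqrt t * |x| / (Real.sqrt 2 * s) = z * t := by
    rw [hz, ← hst2, Real.sqrt_sq hst.le]
    field_simp
  have hta : t ^ a = t ^ (a - 1 / 2) * Real.sqrt t := by
    rw [Real.sqrt_eq_rpow, ← Real.rpow_add ht]
    congr 1
    ring
  rw [hy, hzt, Real.mul_rpow hz0.le ht.le]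
  congr 2
  rw [hC, hta, Real.sqrt_mul (by norm_num), Real.sqrt_mul (by norm_num)]
  field_simp
  rw [hs22]

/-! ### The mixed density and its absolute convergence -/

section MixedKernel

variable {c t a v : ℝ} {d : ℕ} {x : ℝ}

lemma measurable_mixedKernel (c t a v : ℝ) (d : ℕ) (x : ℝ) :
    Measurable (mixedKernel c t a v d x) := by
  have := measurable_modifiedBesselK (1 / 2 - a)
  unfold mixedKernel
  fun_prop

lemma betaPDF_mul_lintegral_eq (hc : 0 < c) (ht : 0 < t) (ha : 0 < a) (hx : x ≠ 0) (w : ℝ) :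
    betaPDF ((d : ℝ) / 2) (v - (d : ℝ) / 2 + 1) w *
      ∫⁻ g, ENNReal.ofReal (normalDensity (c * Real.sqrt g * Real.sqrt w) x) ∂(gammaMeasure a t) =
    (Set.Ioo (0 : ℝ) 1).indicator (fun w => ENNReal.ofReal
      (1 / (Real.Gamma a * beta ((d : ℝ) / 2) (v - (d : ℝ) / 2 + 1)) *
        mixedKernel c t a v d x w)) w := by
  simp only [Set.indicator_apply]
  split_ifs with hw
  · have hsw : 0 < Real.sqrt w := Real.sqrt_pos.mpr hw.1
    have h1w : 0 < 1 - w := by linarith [hw.2]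
    simp only [mul_right_comm c]
    rw [lintegral_gammaMeasure_normalDensity ha ht (mul_pos hc hsw) hx, betaPDF_of_pos_lt_one hw.1 hw.2,
      ← ENNReal.ofReal_mul']
    · congr 1
      rw [mixedKernel, Real.sqrt_mul Real.pi_pos.le, Real.sqrt_mul (by norm_num : (0 : ℝ) ≤ 2) w,
        show Real.sqrt 2 * (c * Real.sqrt w) = c * (Real.sqrt 2 * Real.sqrt w) by ring,
        show Real.sqrt Real.pi * (c * Real.sqrt w) = Real.sqrt Real.pi * Real.sqrt w * c by ring,
        show v - (d : ℝ) / 2 + 1 - 1 = v - (d : ℝ) / 2 by ring]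
      ring
    · have := Real.Gamma_pos_of_pos ha
      have := modifiedBesselK_nonneg (1 / 2 - a) (Real.sqrt (2 * t) * |x| / (c * Real.sqrt w))
      positivity
  · rw [betaPDF, betaPDFReal, if_neg (by simpa using hw), ENNReal.ofReal_zero, zero_mul]

lemma mixedKernel_nonneg (hc : 0 < c) (w : ℝ) (hw : w ∈ Set.Ioo (0 : ℝ) 1) :
    0 ≤ mixedKernel c t a v d x w := by
  have h1 := hw.1
  have h2 : 0 < 1 - w := by linarith [hw.2]
  have := modifiedBesselK_nonneg (1 / 2 - a) (Real.sqrt (2 * t) * |x| / (c * Real.sqrt w))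
  unfold mixedKernel
  positivity

lemma lintegral_betaMeasure_eq (hc : 0 < c) (ht : 0 < t) (ha : 0 < a) (hx : x ≠ 0) :
    ∫⁻ w, ∫⁻ g, ENNReal.ofReal (normalDensity (c * Real.sqrt g * Real.sqrt w) x)
      ∂(gammaMeasure a t) ∂(betaMeasure ((d : ℝ) / 2) (v - (d : ℝ) / 2 + 1)) =
    ∫⁻ w in Set.Ioo (0 : ℝ) 1, ENNReal.ofReal
      (1 / (Real.Gamma a * beta ((d : ℝ) / 2) (v - (d : ℝ) / 2 + 1)) *
        mixedKernel c t a v d x w) := by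
  have := isProbabilityMeasure_gammaMeasure ha ht
  have hm : Measurable fun z : ℝ × ℝ =>
    ENNReal.ofReal (normalDensity (c * Real.sqrt z.2 * Real.sqrt z.1) x) := by fun_prop
  rw [betaMeasure, lintegral_withDensity_eq_lintegral_mul _ (measurable_betaPDF _ _)
    (hm.lintegral_prod_right' (ν := gammaMeasure a t)), ← lintegral_indicator measurableSet_Ioo]
  exact lintegral_congr fun w => betaPDF_mul_lintegral_eq hc ht ha hx w

/-- Up to a constant the integral of the kernel is an average of normal densities at `x` over two
probability laws, hence at most `1 / |x|`. -/
lemma integrableOn_mixedKernel (hc : 0 < c) (ht : 0 < t) (ha : 0 < a) (hd : 1 ≤ d)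
    (hv : (d : ℝ) / 2 - 1 < v) (hx : x ≠ 0) :
    IntegrableOn (mixedKernel c t a v d x) (Set.Ioo 0 1) := by
  have hp : 0 < (d : ℝ) / 2 := by positivity
  have hq : 0 < v - (d : ℝ) / 2 + 1 := by linarith
  have := isProbabilityMeasure_gammaMeasure ha ht
  have := isProbabilityMeasureBeta hp hq
  have hb := beta_pos hp hq
  have hG := Real.Gamma_pos_of_pos ha
  have hC : 0 < 1 / (Real.Gamma a * beta ((d : ℝ) / 2) (v - (d : ℝ) / 2 + 1)) := by positivity
  have hmeas := measurable_mixedKernel c t a v d x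
  suffices h : IntegrableOn (fun w => 1 / (Real.Gamma a * beta ((d : ℝ) / 2) (v - (d : ℝ) / 2 + 1)) *
      mixedKernel c t a v d x w) (Set.Ioo 0 1) from
    (integrable_const_mul_iff (IsUnit.mk0 _ hC.ne') _).mp h
  rw [IntegrableOn, ← lintegral_ofReal_ne_top_iff_integrable
    (hmeas.const_mul _).aestronglyMeasurable, ← lintegral_betaMeasure_eq hc ht ha hx]
  · refine ne_top_of_le_ne_top (ENNReal.ofReal_ne_top (r := 1 / |x|)) ?_
    calc _ ≤ ∫⁻ w, ∫⁻ g, ENNReal.ofReal (1 / |x|) ∂(gammaMeasure a t)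
          ∂(betaMeasure ((d : ℝ) / 2) (v - (d : ℝ) / 2 + 1)) :=
          lintegral_mono fun w => lintegral_mono fun g =>
            ENNReal.ofReal_le_ofReal (normalDensity_le (by positivity) hx)
      _ = ENNReal.ofReal (1 / |x|) := by simp
  · filter_upwards [ae_restrict_mem measurableSet_Ioo] with w hw
    exact mul_nonneg hC.le (mixedKernel_nonneg hc w hw)

lemma lintegral_betaMeasure_eq_mixedDensity (hc : 0 < c) (ht : 0 < t) (ha : 0 < a) (hd : 1 ≤ d)
    (hv : (d : ℝ) / 2 - 1 < v) (hx : x ≠ 0) :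
    ∫⁻ w, ∫⁻ g, ENNReal.ofReal (normalDensity (c * Real.sqrt g * Real.sqrt w) x)
      ∂(gammaMeasure a t) ∂(betaMeasure ((d : ℝ) / 2) (v - (d : ℝ) / 2 + 1)) =
    ENNReal.ofReal (mixedDensity c t a v d x) := by
  have hp : 0 < (d : ℝ) / 2 := by positivity
  have hq : 0 < v - (d : ℝ) / 2 + 1 := by linarith
  have hb := beta_pos hp hq
  have hG := Real.Gamma_pos_of_pos ha
  rw [lintegral_betaMeasure_eq hc ht ha hx, mixedDensity, ← integral_const_mul,
    ofReal_integral_eq_lintegral_ofReal]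
  · exact (integrableOn_mixedKernel hc ht ha hd hv hx).const_mul _
  · filter_upwards [ae_restrict_mem measurableSet_Ioo] with w hw
    exact mul_nonneg (by positivity) (mixedKernel_nonneg hc w hw)

theorem lintegral_normalBetaMixture_eq_mixedDensity (hc : 0 < c) (ht : 0 < t) (ha : 0 < a)
    (hd : 1 ≤ d) (hv : (d : ℝ) / 2 - 1 < v) {A : Set ℝ} (hA : MeasurableSet A) :
    ∫⁻ g, normalBetaMixture (c * Real.sqrt g) ((d : ℝ) / 2) (v - (d : ℝ) / 2 + 1) A
      ∂(gammaMeasure a t) =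
    ∫⁻ x in A, ENNReal.ofReal (mixedDensity c t a v d x) := by
  rw [lintegral_normalBetaMixture ha ht hc (by positivity) (by linarith) hA]
  refine lintegral_congr_ae (ae_restrict_of_ae ?_)
  filter_upwards [Measure.ae_ne volume (0 : ℝ)] with x hx using
    lintegral_betaMeasure_eq_mixedDensity hc ht ha hd hv hx

end MixedKernel

/-! ### The Bessel process at an independent gamma time -/

/-- The value of a path at a real time, as a limit along rational times. It agrees with evaluation
for continuous paths, and is measurable for the product σ-algebra on paths. -/
noncomputable def gridEval (z : (ℝ≥0 → ℝ) × ℝ) : ℝ :=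
  Filter.limsup (fun k : ℕ => z.1 ((⌊z.2 * k⌋₊ : ℝ≥0) / k)) Filter.atTop

lemma measurable_gridEval : Measurable gridEval := by
  refine Measurable.limsup fun k => ?_
  have h : Measurable fun p : ℕ × (ℝ≥0 → ℝ) => p.2 ((p.1 : ℝ≥0) / k) :=
    measurable_from_prod_countable_right fun n => measurable_pi_apply ((n : ℝ≥0) / (k : ℝ≥0))
  exact h.comp ((Nat.measurable_floor.comp (by fun_prop)).prodMk measurable_fst)

lemma gridEval_eq {f : ℝ≥0 → ℝ} (hf : Continuous f) {g : ℝ} (hg : 0 ≤ g) :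
    gridEval (f, g) = f g.toNNReal := by
  have h1 : Filter.Tendsto (fun k : ℕ => ((⌊g * k⌋₊ : ℝ≥0) / k)) Filter.atTop (nhds g.toNNReal) := by
    rw [← NNReal.tendsto_coe, Real.coe_toNNReal _ hg]
    have := (tendsto_nat_floor_mul_div_atTop hg).comp (tendsto_natCast_atTop_atTop (R := ℝ))
    refine this.congr fun k => ?_
    simp
  exact ((hf.tendsto _).comp h1).limsup_eq

/-- The Bessel clock as a measurable function of the paths and the random time. -/
noncomputable def gridClock {d : ℕ} (z : (Fin d → ℝ≥0 → ℝ) × ℝ) : ℝ :=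
  Real.sqrt (∑ i, gridEval (z.1 i, z.2) ^ 2)

lemma measurable_gridClock {d : ℕ} : Measurable (gridClock (d := d)) := by
  refine (Finset.measurable_fun_sum _ fun i _ => Measurable.pow_const ?_ 2).sqrt
  exact measurable_gridEval.comp (by fun_prop)

section Clock

variable {Ω : Type*} [MeasurableSpace Ω] {P : Measure Ω} {d : ℕ}
  {B : Fin d → ℝ≥0 → Ω → ℝ} {a t : ℝ} {G : ℝ → Ω → ℝ}

lemma ae_gridClock_eq (hB : IsIndepBrownian P B) :
    ∀ᵐ ω ∂P, ∀ g : ℝ, 0 ≤ g → gridClock (fun i s => B i s ω, g) = besselProcess B g.toNNReal ω := by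
  have h : ∀ᵐ ω ∂P, ∀ i, Continuous fun s => B i s ω :=
    ae_all_iff.mpr fun i => (hB.brownian i).cont
  filter_upwards [h] with ω hω g hg
  simp only [gridClock, besselProcess]
  congr 1
  exact Finset.sum_congr rfl fun i _ => by rw [gridEval_eq (hω i) hg]

lemma ae_clock_eq_gridClock (hB : IsIndepBrownian P B) (hG : IsGammaTime P a G) (ht : 0 < t) :
    (fun ω => gridClock (fun i s => B i s ω, G t ω)) =ᵐ[P]
      fun ω => besselProcess B (G t ω).toNNReal ω := by
  have h := gammaMeasure_ae_pos a t
  rw [← (hG.law t ht).map_eq] at h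
  filter_upwards [ae_gridClock_eq hB, ae_of_ae_map (hG.law t ht).aemeasurable h] with ω h1 h2
    using h1 _ h2.le

lemma measurable_paths (hB : IsIndepBrownian P B) :
    Measurable fun ω (i : Fin d) (s : ℝ≥0) => B i s ω :=
  measurable_pi_lambda _ fun i => measurable_pi_lambda _ fun s => hB.measurable i s

/-- Evaluation of a path at a random time is not measurable on the full product space of paths;
almost sure continuity lets the grid version replace it. -/
lemma aemeasurable_clock (hB : IsIndepBrownian P B) (hG : IsGammaTime P a G) (ht : 0 < t) :
    AEMeasurable (fun ω => besselProcess B (G t ω).toNNReal ω) P :=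
  ⟨_, measurable_gridClock.comp ((measurable_paths hB).prodMk (hG.measurable t)),
    (ae_clock_eq_gridClock hB hG ht).symm⟩

variable [IsProbabilityMeasure P]

/-- By independence of paths and gamma time, the law of the clock is the gamma mixture of the Bessel
laws at deterministic times. -/
lemma lintegral_map_clock (hB : IsIndepBrownian P B) (hG : IsGammaTime P a G) (ha : 0 < a)
    (ht : 0 < t) (hBG : IndepFun (fun ω (i : Fin d) (s : ℝ≥0) => B i s ω) (G t) P)
    {f : ℝ → ℝ≥0∞} (hf : Measurable f) :
    ∫⁻ s, f s ∂(P.map fun ω => besselProcess B (G t ω).toNNReal ω) =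
      ∫⁻ g, ∫⁻ s, f s ∂(P.map (besselProcess B g.toNNReal)) ∂(gammaMeasure a t) := by
  have := isProbabilityMeasure_gammaMeasure ha ht
  have hpm := measurable_paths hB
  have hGm := hG.measurable t
  have hF : Measurable fun z : (Fin d → ℝ≥0 → ℝ) × ℝ => f (gridClock z) :=
    hf.comp measurable_gridClock
  have hc : Measurable fun ω => gridClock (fun i s => B i s ω, G t ω) :=
    measurable_gridClock.comp (hpm.prodMk hGm)
  have := Measure.isProbabilityMeasure_map (μ := P) hpm.aemeasurable
  rw [← Measure.map_congr (ae_clock_eq_gridClock hB hG ht),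
    lintegral_map hf hc,
    ← lintegral_map (f := fun z => f (gridClock z)) hF (hpm.prodMk hGm),
    (indepFun_iff_map_prod_eq_prod_map_map hpm.aemeasurable hGm.aemeasurable).mp hBG,
    (hG.law t ht).map_eq, lintegral_prod_symm' _ hF]
  refine lintegral_congr_ae ?_
  filter_upwards [gammaMeasure_ae_pos a t] with g hg
  rw [lintegral_map (f := fun b => f (gridClock (b, g))) (hF.comp (by fun_prop)) hpm,
    lintegral_map hf (measurable_besselProcess hB.measurable _)]
  refine lintegral_congr_ae ?_
  filter_upwards [ae_gridClock_eq hB] with ω hω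
  rw [hω g hg.le]

lemma ae_clock_pos (hB : IsIndepBrownian P B) (hG : IsGammaTime P a G) (ha : 0 < a)
    (ht : 0 < t) (hd : 1 ≤ d)
    (hBG : IndepFun (fun ω (i : Fin d) (s : ℝ≥0) => B i s ω) (G t) P) :
    ∀ᵐ s ∂(P.map fun ω => besselProcess B (G t ω).toNNReal ω), 0 < s := by
  have hm : Measurable ((Set.Iic (0 : ℝ)).indicator (1 : ℝ → ℝ≥0∞)) :=
    measurable_one.indicator measurableSet_Iic
  have h := lintegral_map_clock hB hG ha ht hBG hm
  rw [lintegral_indicator_one measurableSet_Iic] at h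
  have h0 : ∫⁻ g, ∫⁻ s, (Set.Iic (0 : ℝ)).indicator (1 : ℝ → ℝ≥0∞) s
      ∂(P.map (besselProcess B g.toNNReal)) ∂(gammaMeasure a t) = 0 := by
    rw [lintegral_congr_ae (g := 0), lintegral_zero_fun]
    filter_upwards [gammaMeasure_ae_pos a t] with g hg
    have := besselProcess_ae_pos hB hd (Real.toNNReal_pos.mpr hg).ne'
    rw [lintegral_indicator_one measurableSet_Iic]
    simpa [ae_iff, Set.Iic] using this
  rw [h0] at h
  simpa [ae_iff, Set.Iic] using h

end Clock

/-! ### Identification of the conditional distribution -/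

section Conditioning

variable {Ω : Type*} [MeasurableSpace Ω] {P : Measure Ω}
  {S θ : ℕ → Ω → ℝ} {T : Ω → ℝ} {c : ℝ} {n : ℕ}

lemma aemeasurable_eventCount_clock (hS : ∀ j, Measurable (S j)) (hT : AEMeasurable T P) :
    AEMeasurable (fun ω => eventCount S (T ω) ω) P := by
  have hid : AEMeasurable (fun ω => (ω, T ω)) P := aemeasurable_id'.prodMk hT
  have h := (measurable_eventCount hS).comp_aemeasurable hid
  exact h

lemma aemeasurable_frictionPosition_clock (hS : ∀ j, Measurable (S j))
    (hθ : ∀ j, Measurable (θ j)) (hT : AEMeasurable T P) (c : ℝ) :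
    AEMeasurable (fun ω => frictionPosition c S θ (T ω) ω) P := by
  have hid : AEMeasurable (fun ω => (ω, T ω)) P := aemeasurable_id'.prodMk hT
  have h := (measurable_frictionPosition hS hθ c).comp_aemeasurable hid
  exact h

variable [IsProbabilityMeasure P]

lemma lintegral_comp_of_indepFun {E : Type*} [MeasurableSpace E] {U : Ω → E}
    (hU : Measurable U) (hT : AEMeasurable T P) (h : IndepFun U T P) {H : E × ℝ → ℝ≥0∞}
    (hH : Measurable H) :
    ∫⁻ ω, H (U ω, T ω) ∂P = ∫⁻ s, ∫⁻ ω, H (U ω, s) ∂P ∂(P.map T) := by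
  rw [← lintegral_map' (f := H) hH.aemeasurable (hU.aemeasurable.prodMk hT),
    (indepFun_iff_map_prod_eq_prod_map_map hU.aemeasurable hT).mp h, lintegral_prod_symm' _ hH]
  refine lintegral_congr fun s => ?_
  rw [lintegral_map (f := fun u => H (u, s)) (hH.comp (by fun_prop)) hU]

lemma measurableSet_count_position (hS : ∀ j, Measurable (S j)) (hθ : ∀ j, Measurable (θ j))
    (c : ℝ) (n : ℕ) {A : Set ℝ} (hA : MeasurableSet A) :
    MeasurableSet {z : Ω × ℝ | eventCount S z.2 z.1 = n ∧ frictionPosition c S θ z.2 z.1 ∈ A} :=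
  (measurable_eventCount hS (measurableSet_singleton n)).inter
    (measurable_frictionPosition hS hθ c hA)

/-- The event times and the angles, as a random pair of sequences. -/
def drivingData (S θ : ℕ → Ω → ℝ) (ω : Ω) : (ℕ → ℝ) × (ℕ → ℝ) := (fun j => S j ω, fun j => θ j ω)

lemma lintegral_count_position_clock (hS : ∀ j, Measurable (S j)) (hθ : ∀ j, Measurable (θ j))
    (hT : AEMeasurable T P) (hind : IndepFun (drivingData S θ) T P) (c : ℝ) (n : ℕ) {A : Set ℝ}
    (hA : MeasurableSet A) {f : ℝ → ℝ≥0∞} (hf : Measurable f) :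
    ∫⁻ ω, {z : Ω × ℝ | eventCount S z.2 z.1 = n ∧ frictionPosition c S θ z.2 z.1 ∈ A}.indicator
        (fun z => f z.2) (ω, T ω) ∂P =
      ∫⁻ s, f s * P {ω | eventCount S s ω = n ∧ frictionPosition c S θ s ω ∈ A} ∂(P.map T) := by
  classical
  have hU : Measurable (drivingData S θ) := by
    unfold drivingData
    fun_prop
  -- The count and position are taken on the space of driving sequences with coordinate maps, which
  -- exhibits them as functions of `drivingData` and the time only.
  have hset := measurableSet_count_position (Ω := (ℕ → ℝ) × (ℕ → ℝ)) (S := fun j p => p.1 j)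
    (θ := fun j p => p.2 j) (fun j => by fun_prop) (fun j => by fun_prop) c n hA
  have hH := (hf.comp measurable_snd).indicator hset
  have key := lintegral_comp_of_indepFun hU hT hind hH
  refine Eq.trans ?_ (key.trans ?_)
  · rfl
  · refine lintegral_congr fun s => ?_
    have hs : MeasurableSet {ω | eventCount S s ω = n ∧ frictionPosition c S θ s ω ∈ A} :=
      (measurableSet_count_position hS hθ c n hA).preimage
        (measurable_id.prodMk (measurable_const (a := s)))
    rw [← lintegral_indicator_const hs]
    rfl

lemma measure_eventCount_eq {lam : ℝ} {m : Fin 2}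
    (hX : IsFrictionMotion P lam ((m : ℕ) : ℝ) S θ) (hlam : 0 < lam) {s : ℝ} (hs : 0 < s)
    (hn : 1 ≤ n) : P {ω | eventCount S s ω = n} = ENNReal.ofReal (poissonWeight lam n s) := by
  have h := integral_eventPosition_pow hX hlam 1 hs.le hn 0
  have hset : MeasurableSet {ω | eventCount S s ω = n} :=
    ((measurable_eventCount hX.measurable_time).comp
      (measurable_id.prodMk (measurable_const (a := s)))) (measurableSet_singleton n)
  have e : (fun ω => if eventCount S s ω = n then frictionPosition 1 S θ s ω ^ 0 else 0) =
      {ω | eventCount S s ω = n}.indicator 1 := by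
    ext ω
    simp [Set.indicator_apply]
  rw [e, integral_indicator_one hset] at h
  rw [← ofReal_measureReal, h, frictionMoment, poissonWeight]
  simp

lemma setLIntegral_mul_measure_eventCount_eq (hS : ∀ j, Measurable (S j))
    (hθ : ∀ j, Measurable (θ j)) (hT : AEMeasurable T P) (hind : IndepFun (drivingData S θ) T P)
    {F : ℕ × ℝ → ℝ≥0∞} (hF : Measurable F) {C : Set ℝ} (hC : MeasurableSet C) :
    ∫⁻ s in C, F (n, s) * P {ω | eventCount S s ω = n} ∂(P.map T) =
      ∫⁻ p in {n} ×ˢ C, F p ∂(P.map fun ω => (eventCount S (T ω) ω, T ω)) := by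
  classical
  have hNm : AEMeasurable (fun ω => (eventCount S (T ω) ω, T ω)) P :=
    (aemeasurable_eventCount_clock hS hT).prodMk hT
  have hFn : Measurable fun s => F (n, s) := hF.comp (measurable_const.prodMk measurable_id)
  have hnC : MeasurableSet (({n} : Set ℕ) ×ˢ C) := (measurableSet_singleton n).prod hC
  -- With the whole line as target set the constraint on the position is vacuous, so the speed `0`
  -- is an arbitrary choice.
  have h2 := lintegral_count_position_clock hS hθ hT hind 0 n MeasurableSet.univ
    (hFn.indicator hC)
  rw [← lintegral_indicator hC, ← lintegral_indicator hnC,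
    lintegral_map' (hF.indicator hnC).aemeasurable hNm]
  simp only [Set.mem_univ, and_true] at h2
  refine Eq.trans ?_ (h2.symm.trans ?_)
  · refine lintegral_congr fun s => ?_
    show _ = C.indicator (fun s => F (n, s)) s * P {ω | eventCount S s ω = n}
    simp only [Set.indicator_apply]
    split_ifs <;> simp
  · refine lintegral_congr fun ω => ?_
    simp only [Set.indicator_apply, Set.mem_ofPred_eq, Set.mem_prod, Set.mem_singleton_iff]
    by_cases hN : eventCount S (T ω) ω = n <;> by_cases hTC : T ω ∈ C <;> simp [hN, hTC]

lemma setLIntegral_measure_count_position (hS : ∀ j, Measurable (S j))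
    (hθ : ∀ j, Measurable (θ j)) (hT : AEMeasurable T P) (hind : IndepFun (drivingData S θ) T P)
    {A C : Set ℝ} (hA : MeasurableSet A) (hC : MeasurableSet C) :
    ∫⁻ s in C, P {ω | eventCount S s ω = n ∧ frictionPosition c S θ s ω ∈ A} ∂(P.map T) =
      (P.map fun ω => ((eventCount S (T ω) ω, T ω), frictionPosition c S θ (T ω) ω))
        (({n} ×ˢ C) ×ˢ A) := by
  classical
  have hXm : AEMeasurable (fun ω => frictionPosition c S θ (T ω) ω) P :=
    aemeasurable_frictionPosition_clock hS hθ hT c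
  have hNm : AEMeasurable (fun ω => (eventCount S (T ω) ω, T ω)) P :=
    (aemeasurable_eventCount_clock hS hT).prodMk hT
  have hnC : MeasurableSet ((({n} : Set ℕ) ×ˢ C) ×ˢ A) :=
    ((measurableSet_singleton n).prod hC).prod hA
  have h2 := lintegral_count_position_clock hS hθ hT hind c n hA
    ((measurable_const (a := (1 : ℝ≥0∞))).indicator hC)
  rw [← lintegral_indicator hC, ← lintegral_indicator_one hnC,
    lintegral_map' (measurable_one.indicator hnC).aemeasurable (hNm.prodMk hXm)]
  refine Eq.trans ?_ (h2.symm.trans ?_)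
  · refine lintegral_congr fun s => ?_
    show _ = C.indicator (fun _ => 1) s *
      P {ω | eventCount S s ω = n ∧ frictionPosition c S θ s ω ∈ A}
    simp only [Set.indicator_apply]
    split_ifs <;> simp
  · refine lintegral_congr fun ω => ?_
    simp only [Set.indicator_apply, Set.mem_ofPred_eq, Set.mem_prod, Set.mem_singleton_iff,
      Pi.one_apply]
    by_cases hN : eventCount S (T ω) ω = n <;> by_cases hTC : T ω ∈ C <;>
      by_cases hXA : frictionPosition c S θ (T ω) ω ∈ A <;> simp [hN, hTC, hXA]

lemma measurable_measure_count_position (hS : ∀ j, Measurable (S j))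
    (hθ : ∀ j, Measurable (θ j)) {A : Set ℝ} (hA : MeasurableSet A) :
    Measurable fun s => P {ω | eventCount S s ω = n ∧ frictionPosition c S θ s ω ∈ A} :=
  measurable_measure_prodMk_right (measurableSet_count_position hS hθ c n hA)

/-- Both sides have the same integral over every measurable set `C` of clock values, namely the
joint probability of `n` events, clock in `C` and position in `A`: on the left by disintegration, on
the right by independence. -/
lemma condDistrib_mul_measure_eventCount_ae_eq (hS : ∀ j, Measurable (S j))
    (hθ : ∀ j, Measurable (θ j)) (hT : AEMeasurable T P)
    (hind : IndepFun (drivingData S θ) T P) {A : Set ℝ} (hA : MeasurableSet A) :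
    (fun s => condDistrib (fun ω => frictionPosition c S θ (T ω) ω)
      (fun ω => (eventCount S (T ω) ω, T ω)) P (n, s) A * P {ω | eventCount S s ω = n})
      =ᵐ[P.map T]
      fun s => P {ω | eventCount S s ω = n ∧ frictionPosition c S θ s ω ∈ A} := by
  have hXm : AEMeasurable (fun ω => frictionPosition c S θ (T ω) ω) P :=
    aemeasurable_frictionPosition_clock hS hθ hT c
  have hF := Kernel.measurable_coe (condDistrib (fun ω => frictionPosition c S θ (T ω) ω)
    (fun ω => (eventCount S (T ω) ω, T ω)) P) hA
  have hN : Measurable fun s => P {ω | eventCount S s ω = n} := by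
    simpa using measurable_measure_count_position (P := P) (c := 0) (n := n) hS hθ
      MeasurableSet.univ
  have := Measure.isProbabilityMeasure_map (μ := P) hT
  refine ae_eq_of_forall_setLIntegral_eq_of_sigmaFinite
    ((hF.comp (measurable_const.prodMk measurable_id)).mul hN)
    (measurable_measure_count_position hS hθ hA) fun C hC _ => ?_
  rw [setLIntegral_measure_count_position hS hθ hT hind hA hC, ← compProd_map_condDistrib hXm,
    Measure.compProd_apply_prod ((measurableSet_singleton n).prod hC) hA]
  exact setLIntegral_mul_measure_eventCount_eq hS hθ hT hind hF hC

/-- At positive times the count has positive Poisson probability, so the preceding almost everywhere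
identity can be divided by it. -/
lemma clockConditionalLaw_apply {lam : ℝ} {m : Fin 2}
    (hX : IsFrictionMotion P lam ((m : ℕ) : ℝ) S θ) (hlam : 0 < lam) (hn : 1 ≤ n)
    (hT : AEMeasurable T P) (hTpos : ∀ᵐ s ∂(P.map T), 0 < s)
    (hind : IndepFun (drivingData S θ) T P) {A : Set ℝ} (hA : MeasurableSet A) :
    clockConditionalLaw P (frictionPosition c S θ) (eventCount S) T n A =
      ∫⁻ s, ENNReal.ofReal (1 / poissonWeight lam n s) *
        P {ω | eventCount S s ω = n ∧ frictionPosition c S θ s ω ∈ A} ∂(P.map T) := by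
  have hm : Measurable fun s => condDistrib (fun ω => frictionPosition c S θ (T ω) ω)
      (fun ω => (eventCount S (T ω) ω, T ω)) P (n, s) :=
    (Kernel.measurable _).comp (measurable_const.prodMk measurable_id)
  rw [clockConditionalLaw, Measure.bind_apply hA hm.aemeasurable]
  refine lintegral_congr_ae ?_
  filter_upwards [condDistrib_mul_measure_eventCount_ae_eq (c := c) (n := n)
    hX.measurable_time hX.measurable_angle hT hind hA, hTpos] with s hs hspos
  have hp := poissonWeight_pos hlam hspos n
  rw [← hs, measure_eventCount_eq hX hlam hspos hn, mul_comm _ (ENNReal.ofReal (poissonWeight _ _ _)),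
    ← mul_assoc, ← ENNReal.ofReal_mul (by positivity), one_div_mul_cancel hp.ne',
    ENNReal.ofReal_one, one_mul]

end Conditioning

/-! ### Assembly -/

theorem theorem10 {Ω : Type*} [MeasurableSpace Ω] (P : Measure Ω) [IsProbabilityMeasure P]
    (c lam a t : ℝ) (hc : 0 < c) (hlam : 0 < lam) (ha : 0 < a) (ht : 0 < t)
    (m : Fin 2) (d n : ℕ) (hd : 1 ≤ d) (hn : 1 ≤ n)
    (hv : (d : ℝ) / 2 - 1 < motionIndex m n)
    (S θ : ℕ → Ω → ℝ) (hX : IsFrictionMotion P lam ((m : ℕ) : ℝ) S θ)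
    (B : Fin d → ℝ≥0 → Ω → ℝ) (hB : IsIndepBrownian P B)
    (G : ℝ → Ω → ℝ) (hG : IsGammaTime P a G)
    (hBG : IndepFun (fun ω (i : Fin d) (s : ℝ≥0) => B i s ω) (G t) P)
    (hXT : IndepFun (fun ω => ((fun j => S j ω), (fun j => θ j ω)))
      (fun ω => ((fun (i : Fin d) (s : ℝ≥0) => B i s ω), G t ω)) P) :
    (∀ x : ℝ, x ≠ 0 →
      IntegrableOn (mixedKernel c t a (motionIndex m n) d x) (Set.Ioo 0 1)) ∧
    clockConditionalLaw P (frictionPosition c S θ) (eventCount S)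
        (fun ω => besselProcess B (G t ω).toNNReal ω) n =
      volume.withDensity
        (fun x => ENNReal.ofReal (mixedDensity c t a (motionIndex m n) d x)) := by
  refine ⟨fun x hx => integrableOn_mixedKernel hc ht ha hd hv hx, Measure.ext fun A hA => ?_⟩
  have hS := hX.measurable_time
  have hθ := hX.measurable_angle
  -- Independence passes to the clock through its measurable version and almost sure equality.
  have hind : IndepFun (drivingData S θ) (fun ω => besselProcess B (G t ω).toNNReal ω) P :=
    (hXT.comp measurable_id measurable_gridClock).congr (Filter.EventuallyEq.refl _ _)
      (ae_clock_eq_gridClock hB hG ht)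
  have hmeas : Measurable fun s => ENNReal.ofReal (1 / poissonWeight lam n s) *
      P {ω | eventCount S s ω = n ∧ frictionPosition c S θ s ω ∈ A} :=
    ((measurable_poissonWeight lam n).const_div 1).ennreal_ofReal.mul
      (measurable_measure_count_position hS hθ hA)
  rw [clockConditionalLaw_apply hX hlam hn (aemeasurable_clock hB hG ht)
    (ae_clock_pos hB hG ha ht hd hBG) hind hA, lintegral_map_clock hB hG ha ht hBG hmeas,
    withDensity_apply _ hA, ← lintegral_normalBetaMixture_eq_mixedDensity hc ht ha hd hv hA]
  refine lintegral_congr_ae ?_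
  -- After disintegration over the gamma time, the claim reduces to the identification of the law at
  -- each fixed positive `g`.
  filter_upwards [gammaMeasure_ae_pos a t] with g hg
  have hg' : g.toNNReal ≠ 0 := (Real.toNNReal_pos.mpr hg).ne'
  have := Measure.isProbabilityMeasure_map (μ := P)
    (measurable_besselProcess hB.measurable g.toNNReal).aemeasurable
  rw [← countConditionedLaw.apply hS hθ hA,
    countConditionedLaw_besselProcess hX hlam hc.le hn hB hd hv hg', Real.coe_toNNReal _ hg.le]
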